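/- Let $(G,H,t,m)$ be a Lie crossed module: $G,H$ are (finite-dimensional, real) Lie groups, $t:H\to G$ is a smooth homomorphism, $m:G\times H\to H$ is a smooth action of $G$ on $H$ by automorphisms, and $t(m(a)(A))=a\,t(A)\,a^{-1}$, $m(t(A))(B)=ABA^{-1}$ for $a\in G$, $A,B\in H$. Let $\mathfrak h$ be the Lie algebra of $H$ and let $\dot m(a):\mathfrak h\to\mathfrak h$ be the differential of $m(a)$ at $1_H$. All maps and forms below are smooth. A $(G,H)$-cocycle $(f,g,W)$ consists of maps $f(x',x;y)\in G$, $g(x;y',y)\in G$, $W(x',x;y',y)\in H$ of real variables with $$t(W(x',x;y',y))=g(x;y',y)^{-1}f(x',x;y')^{-1}g(x';y',y)f(x',x;y),$$ $$f(x'',x;y)=f(x'',x';y)f(x',x;y),\qquad g(x;y'',y)=g(x;y'',y')g(x;y',y),$$ $$W(x'',x;y',y)=W(x',x;y',y)\,m(f(x',x;y)^{-1})(W(x'',x';y',y)),$$ $$W(x',x;y'',y)=m(g(x;y',y)^{-1})(W(x',x;y'',y'))\,W(x',x;y',y).$$ Fix such a cocycle. An $(f,g,W)$-1-gauge transformation $(\kappa,\Psi,\Phi)$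 consists of maps $\kappa(x;y)\in G$, $\Psi(x',x;y)\in H$, $\Phi(x;y',y)\in H$ of real variables with $$\Psi(x'',x;y)=\Psi(x',x;y)\,m(f(x',x;y)^{-1})(\Psi(x'',x';y)),$$ $$\Phi(x;y'',y)=\Phi(x;y',y)\,m(g(x;y',y)^{-1})(\Phi(x;y'',y')).$$ A differential $(G,H)$-1-gauge transformation is a pair $(\varkappa,\Gamma)$ of a map $\varkappa:\mathbb R^2\to G$ and an $\mathfrak h$-valued 1-form $\Gamma=\Gamma_x\,dx+\Gamma_y\,dy$ on $\mathbb R^2$. Then there is a bijection between the set of $(f,g,W)$-1-gauge transformations and the set of differential $(G,H)$-1-gauge transformations, given explicitly as follows. The pair $(\varkappa,\Gamma)$ corresponding to $(\kappa,\Psi,\Phi)$ is $$\varkappa(x,y)=\kappa(x;y),$$ $$\Gamma_x(x,y)=-\dot m(\kappa(x;y))\big(\Psi(x',x;y)^{-1}\partial_{x'}\Psi(x',x;y)\big|_{x'=x}\big),$$ $$\Gamma_y(x,y)=-\dot m(\kappa(x;y))\big(\Phi(x;y',y)^{-1}\partial_{y'}\Phi(x;y',y)\big|_{y'=y}\big).$$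 Conversely, the triple $(\kappa,\Psi,\Phi)$ corresponding to $(\varkappa,\Gamma)$ is $\kappa(x;y)=\varkappa(x,y)$, $\Psi(x,x_0;y)=\Lambda_{|y,x_0}(x)$, $\Phi(x;y,y_0)=\Xi_{|x,y_0}(y)$, where for all fixed $y,x_0$ (respectively $x,y_0$) the curves $\Lambda_{|y,x_0},\Xi_{|x,y_0}:\mathbb R\to H$ are the unique solutions of $$\Lambda_{|y,x_0}(x)^{-1}\partial_x\Lambda_{|y,x_0}(x)=-\dot m\big(f(x,x_0;y)^{-1}\varkappa(x,y)^{-1}\big)(\Gamma_x(x,y)),\qquad \Lambda_{|y,x_0}(x_0)=1_H,$$ $$\Xi_{|x,y_0}(y)^{-1}\partial_y\Xi_{|x,y_0}(y)=-\dot m\big(g(x;y,y_0)^{-1}\varkappa(x,y)^{-1}\big)(\Gamma_y(x,y)),\qquad \Xi_{|x,y_0}(y_0)=1_H.$$ -/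

import Mathlib

open scoped Manifold ContDiff

noncomputable section

namespace HigherGauge

/-- The left logarithmic derivative `γ(s)⁻¹ (dγ/ds)(s)` of a curve `γ` in a Lie group `H`: the
velocity of `γ` at `s`, translated to the identity by left multiplication with `γ(s)⁻¹`.
(The translated vector lives in the tangent space at `γ(s)⁻¹ * γ(s) = 1`.) -/
def leftLogDeriv {E : Type*} [NormedAddCommGroup E] [NormedSpace ℝ E]
    {H : Type*} [TopologicalSpace H] [ChartedSpace E H] [Group H]
    (γ : ℝ → H) (s : ℝ) : GroupLieAlgebra 𝓘(ℝ, E) H :=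
  mfderiv 𝓘(ℝ, E) 𝓘(ℝ, E) (fun h : H => (γ s)⁻¹ * h) (γ s)
    (mfderiv 𝓘(ℝ, ℝ) 𝓘(ℝ, E) γ s (1 : ℝ))

/-- A Lie crossed module `(G, H, t, m)`: Lie groups `G`, `H`, a smooth homomorphism `t : H → G`
and a smooth action `m` of `G` on `H` by automorphisms, such that `t` is equivariant and the
Peiffer identity holds. -/
structure LieCrossedModule
    (EG : Type*) [NormedAddCommGroup EG] [NormedSpace ℝ EG]
    (G : Type*) [TopologicalSpace G] [ChartedSpace EG G] [Group G] [LieGroup 𝓘(ℝ, EG) ∞ G]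
    (EH : Type*) [NormedAddCommGroup EH] [NormedSpace ℝ EH]
    (H : Type*) [TopologicalSpace H] [ChartedSpace EH H] [Group H] [LieGroup 𝓘(ℝ, EH) ∞ H] where
  t : H →* G
  m : G →* MulAut H
  contMDiff_t : ContMDiff 𝓘(ℝ, EH) 𝓘(ℝ, EG) ∞ t
  contMDiff_m : ContMDiff (𝓘(ℝ, EG).prod 𝓘(ℝ, EH)) 𝓘(ℝ, EH) ∞ (fun p : G × H => m p.1 p.2)
  equivariant : ∀ (a : G) (A : H), t (m a A) = a * t A * a⁻¹
  peiffer : ∀ A B : H, m (t A) B = A * B * A⁻¹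

section

variable {EG : Type*} [NormedAddCommGroup EG] [NormedSpace ℝ EG]
  {G : Type*} [TopologicalSpace G] [ChartedSpace EG G] [Group G] [LieGroup 𝓘(ℝ, EG) ∞ G]
  {EH : Type*} [NormedAddCommGroup EH] [NormedSpace ℝ EH]
  {H : Type*} [TopologicalSpace H] [ChartedSpace EH H] [Group H] [LieGroup 𝓘(ℝ, EH) ∞ H]

/-- `ṁ(a)`, the differential at `1` of the automorphism `m(a)` of `H`, acting on the Lie algebra
of `H`. (It takes values in the tangent space at `m(a)(1) = 1`.) -/
def LieCrossedModule.mDot (X : LieCrossedModule EG G EH H) (a : G)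
    (v : GroupLieAlgebra 𝓘(ℝ, EH) H) : GroupLieAlgebra 𝓘(ℝ, EH) H :=
  mfderiv 𝓘(ℝ, EH) 𝓘(ℝ, EH) (fun h : H => X.m a h) (1 : H) v

/-- A `(G, H)`-cocycle. The arguments are ordered as `f(x', x; y)`, `g(x; y', y)` and
`W(x', x; y', y)`. -/
structure Cocycle (X : LieCrossedModule EG G EH H) where
  f : ℝ → ℝ → ℝ → G
  g : ℝ → ℝ → ℝ → G
  W : ℝ → ℝ → ℝ → ℝ → H
  contMDiff_f : ContMDiff 𝓘(ℝ, ℝ × ℝ × ℝ) 𝓘(ℝ, EG) ∞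
    (fun p : ℝ × ℝ × ℝ => f p.1 p.2.1 p.2.2)
  contMDiff_g : ContMDiff 𝓘(ℝ, ℝ × ℝ × ℝ) 𝓘(ℝ, EG) ∞
    (fun p : ℝ × ℝ × ℝ => g p.1 p.2.1 p.2.2)
  contMDiff_W : ContMDiff 𝓘(ℝ, ℝ × ℝ × ℝ × ℝ) 𝓘(ℝ, EH) ∞
    (fun p : ℝ × ℝ × ℝ × ℝ => W p.1 p.2.1 p.2.2.1 p.2.2.2)
  target : ∀ x' x y' y : ℝ,
    X.t (W x' x y' y) = (g x y' y)⁻¹ * (f x' x y')⁻¹ * g x' y' y * f x' x y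
  f_comp : ∀ x'' x' x y : ℝ, f x'' x y = f x'' x' y * f x' x y
  g_comp : ∀ x y'' y' y : ℝ, g x y'' y = g x y'' y' * g x y' y
  W_comp_x : ∀ x'' x' x y' y : ℝ,
    W x'' x y' y = W x' x y' y * X.m (f x' x y)⁻¹ (W x'' x' y' y)
  W_comp_y : ∀ x' x y'' y' y : ℝ,
    W x' x y'' y = X.m (g x y' y)⁻¹ (W x' x y'' y') * W x' x y' y

/-- An `(f, g, W)`-1-gauge transformation `(κ, Ψ, Φ)`, for a cocycle `c = (f, g, W)`. The
arguments are ordered as `κ(x; y)`, `Ψ(x', x; y)` and `Φ(x; y', y)`. -/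
structure IntegralGauge {X : LieCrossedModule EG G EH H} (c : Cocycle X) where
  κ : ℝ → ℝ → G
  Ψ : ℝ → ℝ → ℝ → H
  Φ : ℝ → ℝ → ℝ → H
  contMDiff_κ : ContMDiff 𝓘(ℝ, ℝ × ℝ) 𝓘(ℝ, EG) ∞ (fun p : ℝ × ℝ => κ p.1 p.2)
  contMDiff_Ψ : ContMDiff 𝓘(ℝ, ℝ × ℝ × ℝ) 𝓘(ℝ, EH) ∞
    (fun p : ℝ × ℝ × ℝ => Ψ p.1 p.2.1 p.2.2)
  contMDiff_Φ : ContMDiff 𝓘(ℝ, ℝ × ℝ × ℝ) 𝓘(ℝ, EH) ∞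
    (fun p : ℝ × ℝ × ℝ => Φ p.1 p.2.1 p.2.2)
  Ψ_comp : ∀ x'' x' x y : ℝ,
    Ψ x'' x y = Ψ x' x y * X.m (c.f x' x y)⁻¹ (Ψ x'' x' y)
  Φ_comp : ∀ x y'' y' y : ℝ,
    Φ x y'' y = Φ x y' y * X.m (c.g x y' y)⁻¹ (Φ x y'' y')

end

/-- A differential `(G, H)`-1-gauge transformation: a smooth map `ϰ : ℝ² → G` and a smooth
1-form `Γ` on `ℝ²` with values in the Lie algebra of `H`. Smoothness of `Γ` is expressed in the
normed space `EH` that underlies the tangent space of `H` at `1`. -/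
structure DifferentialGauge
    (EG : Type*) [NormedAddCommGroup EG] [NormedSpace ℝ EG]
    (G : Type*) [TopologicalSpace G] [ChartedSpace EG G]
    (EH : Type*) [NormedAddCommGroup EH] [NormedSpace ℝ EH]
    (H : Type*) [TopologicalSpace H] [ChartedSpace EH H] [Group H] where
  ϰ : ℝ × ℝ → G
  Γ : ℝ × ℝ → (ℝ × ℝ →L[ℝ] GroupLieAlgebra 𝓘(ℝ, EH) H)
  contMDiff_ϰ : ContMDiff 𝓘(ℝ, ℝ × ℝ) 𝓘(ℝ, EG) ∞ ϰ
  contDiff_Γ : ContDiff ℝ ∞ (F := ℝ × ℝ →L[ℝ] EH) Γ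

namespace DifferentialGauge

variable {EG : Type*} [NormedAddCommGroup EG] [NormedSpace ℝ EG]
  {G : Type*} [TopologicalSpace G] [ChartedSpace EG G]
  {EH : Type*} [NormedAddCommGroup EH] [NormedSpace ℝ EH]
  {H : Type*} [TopologicalSpace H] [ChartedSpace EH H] [Group H]

/-- The component `Γ_x(x, y)` of the 1-form `Γ = Γ_x dx + Γ_y dy`. -/
def Γx (D : DifferentialGauge EG G EH H) (x y : ℝ) : GroupLieAlgebra 𝓘(ℝ, EH) H :=
  D.Γ (x, y) ((1 : ℝ), (0 : ℝ))

/-- The component `Γ_y(x, y)` of the 1-form `Γ = Γ_x dx + Γ_y dy`. -/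
def Γy (D : DifferentialGauge EG G EH H) (x y : ℝ) : GroupLieAlgebra 𝓘(ℝ, EH) H :=
  D.Γ (x, y) ((0 : ℝ), (1 : ℝ))

end DifferentialGauge

/-- `γ` is a (differentiable, globally defined) solution of the initial value problem
`γ(s)⁻¹ γ'(s) = ξ(s)`, `γ(s₀) = 1` in the Lie group `H`. -/
def SolvesLeftLog {E : Type*} [NormedAddCommGroup E] [NormedSpace ℝ E]
    {H : Type*} [TopologicalSpace H] [ChartedSpace E H] [Group H]
    (ξ : ℝ → GroupLieAlgebra 𝓘(ℝ, E) H) (s₀ : ℝ) (γ : ℝ → H) : Prop :=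
  MDifferentiable 𝓘(ℝ, ℝ) 𝓘(ℝ, E) γ ∧ (∀ s : ℝ, leftLogDeriv (E := E) γ s = ξ s) ∧ γ s₀ = 1

/-- `γ` is a solution of the initial value problem `γ(s)⁻¹ γ'(s) = ξ(s)`, `γ(s₀) = 1`, and it is
the only one. -/
def IsUniqueSolutionLeftLog {E : Type*} [NormedAddCommGroup E] [NormedSpace ℝ E]
    {H : Type*} [TopologicalSpace H] [ChartedSpace E H] [Group H]
    (ξ : ℝ → GroupLieAlgebra 𝓘(ℝ, E) H) (s₀ : ℝ) (γ : ℝ → H) : Prop :=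
  SolvesLeftLog (E := E) ξ s₀ γ ∧ ∀ γ' : ℝ → H, SolvesLeftLog (E := E) ξ s₀ γ' → γ' = γ

end HigherGauge

end

open scoped Manifold ContDiff

noncomputable section

set_option linter.unusedSectionVars false

namespace HigherGauge

open Set Filter Topology Metric

/-! ### Superposition operators on spaces of continuous functions -/

section Superposition

universe u

variable {K : Type*} [TopologicalSpace K] [CompactSpace K]

/-! The two composition laws are decoupled, and each says that a two-point function is crossed
multiplicative over a transport. Differentiating such a law in its first argument on the diagonal
shows that `Ψ(·, x₀; y)` solves a left logarithmic equation whose right-hand side is the diagonal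
derivative (`generator`) of `Ψ`, twisted by `ṁ(f(x, x₀; y)⁻¹)` (`IsCrossedTransport.solvesLeftLog`).
Since `Γ` is the generator up to the invertible operator `-ṁ(κ)`, this is the equation in the
theorem. `Φ` is handled by the same lemmas after permuting its arguments.

Injectivity is uniqueness for logarithmic equations: if two curves have equal logarithmic
derivatives, their quotient `γ γ'⁻¹` has zero derivative and is constant
(`eq_mul_of_leftLogDeriv_eq`).

Surjectivity needs a solution that is global in `x` and jointly smooth in `(x, y)`
(`exists_isLogSolutionOn_univ`). From a solution `L` of the suitably twisted equation, `m(f(x, 0;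
y))(L(x, y)⁻¹ L(x', y))` is a crossed transport with the prescribed generator
(`exists_isCrossedTransport`). Locally, `L` comes from a smooth flow in the chart at `1`
(`exists_smooth_localFlow`), obtained from the inverse function theorem on a space of curves. Local
solutions extend indefinitely because left translation matches any two of them on an overlap. -/

/-- The pointwise application of a continuous family of operators to a continuous function. -/
def pointwiseApply (E F : Type*) [NormedAddCommGroup E] [NormedSpace ℝ E]
    [NormedAddCommGroup F] [NormedSpace ℝ F] :
    C(K, E →L[ℝ] F) →L[ℝ] C(K, E) →L[ℝ] C(K, F) :=
  LinearMap.mkContinuous₂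
    (LinearMap.mk₂ ℝ
      (fun (A : C(K, E →L[ℝ] F)) (v : C(K, E)) =>
        (⟨fun k => A k (v k), by fun_prop⟩ : C(K, F)))
      (fun _ _ _ => by ext; simp) (fun _ _ _ => by ext; simp)
      (fun _ _ _ => by ext; simp) (fun _ _ _ => by ext; simp)) 1
    (fun A v => by
      rw [ContinuousMap.norm_le _ (by positivity)]
      intro k
      simp only [LinearMap.mk₂_apply, ContinuousMap.coe_mk, one_mul]
      exact (A k).le_of_opNorm_le_of_le (A.norm_coe_le_norm k) (v.norm_coe_le_norm k))

/-- If `f` is continuously differentiable, the superposition operator `u ↦ f ∘ u` on continuous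
functions on a compact space is differentiable. -/
lemma hasFDerivAt_postcomp {E F : Type*} [NormedAddCommGroup E] [NormedSpace ℝ E]
    [NormedAddCommGroup F] [NormedSpace ℝ F]
    (f : C(E, F)) (f' : C(E, E →L[ℝ] F)) (hf : ∀ x, HasFDerivAt f (f' x) x) (u : C(K, E)) :
    HasFDerivAt (fun v : C(K, E) => f.comp v) (pointwiseApply E F (f'.comp u)) u := by
  rw [hasFDerivAt_iff_isLittleO_nhds_zero, Asymptotics.isLittleO_iff]
  intro ε hε
  have hc : ContinuousAt (fun v : C(K, E) => f'.comp v) u :=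
    (ContinuousMap.continuous_postcomp f').continuousAt
  obtain ⟨δ, hδ, h⟩ := (Metric.continuousAt_iff (α := C(K, E)) (β := C(K, E →L[ℝ] F))).1 hc ε hε
  filter_upwards [Metric.ball_mem_nhds (0 : C(K, E)) hδ] with v hv
  rw [ContinuousMap.norm_le _ (by positivity)]
  intro k
  have hvk : ‖v k‖ < δ := (v.norm_coe_le_norm k).trans_lt (by simpa using hv)
  have key := (convex_ball (u k) δ).norm_image_sub_le_of_norm_hasFDerivWithin_le'
    (f := f) (f' := fun x => f' x) (φ := f' (u k)) (C := ε)
    (fun x _ => (hf x).hasFDerivWithinAt) (fun z hz => ?_)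
    (mem_ball_self hδ) (y := u k + v k) (by simpa using hvk)
  · simp only [add_sub_cancel_left] at key
    refine key.trans ?_
    gcongr
    exact v.norm_coe_le_norm k
  -- Translating `u` by a constant so that it passes through `z` at `k` turns continuity of `v ↦ f'
  -- ∘ v` at `u` into a bound on `f' z - f' (u k)` that is uniform in `k`.
  · have hz' : dist (u + ContinuousMap.const K (z - u k)) u < δ := by
      rw [dist_eq_norm, add_sub_cancel_left]
      refine (ContinuousMap.norm_lt_iff _ hδ).2 fun _ => ?_
      simpa [dist_eq_norm] using hz
    have h1 := (ContinuousMap.dist_apply_le_dist k).trans_lt (h hz')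
    simp only [ContinuousMap.comp_apply, ContinuousMap.add_apply, ContinuousMap.const_apply,
      add_sub_cancel, dist_eq_norm] at h1
    exact h1.le

/-- The derivative of superposition by `f` is superposition by `f'` followed by a continuous linear
map, so the order of smoothness goes up by induction. The target `F` varies in the induction, since
`f'` takes values in `E →L[ℝ] F`; this is why both spaces share a universe. -/
lemma contDiff_nat_postcomp {E : Type u} [NormedAddCommGroup E] [NormedSpace ℝ E] (n : ℕ) :
    ∀ {F : Type u} [NormedAddCommGroup F] [NormedSpace ℝ F] (f : C(E, F)),
      ContDiff ℝ n f → ContDiff ℝ n (fun v : C(K, E) => f.comp v) := by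
  induction n with
  | zero =>
    intro F _ _ f _
    exact contDiff_zero.2 (ContinuousMap.continuous_postcomp f)
  | succ n ih =>
    intro F _ _ f hf
    have hf1 : ContDiff ℝ ((n : WithTop ℕ∞) + 1) f := by exact_mod_cast hf
    obtain ⟨hd, -, hf'⟩ := contDiff_succ_iff_fderiv.1 hf1
    let f' : C(E, E →L[ℝ] F) := ⟨fderiv ℝ f, hf'.continuous⟩
    refine contDiff_succ_iff_hasFDerivAt.2 ⟨fun u => pointwiseApply E F (f'.comp u),
      ?_, fun u => ?_⟩
    · have h := ih f' hf'
      fun_prop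
    · exact hasFDerivAt_postcomp f f' (fun x => (hd x).hasFDerivAt) u

/-- The superposition operator of a smooth function is smooth. -/
lemma contDiff_postcomp {E F : Type u} [NormedAddCommGroup E] [NormedSpace ℝ E]
    [NormedAddCommGroup F] [NormedSpace ℝ F] (f : C(E, F)) (hf : ContDiff ℝ ∞ f) :
    ContDiff ℝ ∞ (fun v : C(K, E) => f.comp v) :=
  contDiff_infty.2 fun n => contDiff_nat_postcomp n f (contDiff_infty.1 hf n)

end Superposition

/-! ### Smooth local flows by the inverse function theorem -/

section Flow

variable {E : Type*} [NormedAddCommGroup E] [NormedSpace ℝ E]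

/-- The interval on which rescaled integral curves are defined. -/
abbrev timeInterval : Set ℝ := Icc (-1) 1

/-- Multiplication of times by `r ∈ [-1, 1]`. -/
def scaleTime (r : timeInterval) : C(timeInterval, timeInterval) :=
  ⟨fun s => ⟨r * s, by
    have := abs_le.2 r.2
    have := abs_le.2 s.2
    refine abs_le.1 ?_
    rw [abs_mul]
    nlinarith [abs_nonneg (r : ℝ), abs_nonneg (s : ℝ)]⟩, by fun_prop⟩

@[simp]
lemma coe_scaleTime (r s : timeInterval) : (scaleTime r s : ℝ) = r * s := rfl

/-- The extension of a function on `[-1, 1]` to the real line. -/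
def extendTime (u : C(timeInterval, E)) (s : ℝ) : E := u (projIcc (-1) 1 (by norm_num) s)

lemma continuous_extendTime (u : C(timeInterval, E)) : Continuous (extendTime u) :=
  u.continuous.comp continuous_projIcc

lemma extendTime_coe (u : C(timeInterval, E)) (s : timeInterval) : extendTime u s = u s := by
  simp [extendTime]

/-- The primitive vanishing at `0` of continuous functions on `[-1, 1]`. -/
def primitive (E : Type*) [NormedAddCommGroup E] [NormedSpace ℝ E] :
    C(timeInterval, E) →L[ℝ] C(timeInterval, E) :=
  LinearMap.mkContinuous
    { toFun := fun u => ⟨fun s => ∫ σ in (0 : ℝ)..s, extendTime u σ, by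
        have := intervalIntegral.continuous_primitive
          (fun a b => (continuous_extendTime u).intervalIntegrable a b) 0
          (μ := MeasureTheory.volume)
        exact this.comp continuous_subtype_val⟩
      map_add' := fun u v => by
        ext s
        exact intervalIntegral.integral_add ((continuous_extendTime u).intervalIntegrable _ _)
          ((continuous_extendTime v).intervalIntegrable _ _)
      map_smul' := fun c u => by
        ext s
        exact intervalIntegral.integral_smul c (extendTime u) } 1
    (fun u => by
      rw [ContinuousMap.norm_le _ (by positivity)]
      intro s
      have h := intervalIntegral.norm_integral_le_of_norm_le_const (a := 0) (b := (s : ℝ))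
        (f := extendTime u) (C := ‖u‖) (fun _ _ => u.norm_coe_le_norm _)
      refine h.trans ?_
      rw [sub_zero, one_mul]
      exact mul_le_of_le_one_right (norm_nonneg _) (abs_le.2 s.2))

lemma primitive_apply (u : C(timeInterval, E)) (s : timeInterval) :
    primitive E u s = ∫ σ in (0 : ℝ)..s, extendTime u σ := rfl

/-- Substitution in the integral. It makes the reparametrisation by `r` of a rescaled integral curve
with time factor `ε` one with time factor `r ε`. -/
lemma primitive_comp_scaleTime (u : C(timeInterval, E)) (r : timeInterval) :
    (primitive E u).comp (scaleTime r) = (r : ℝ) • primitive E (u.comp (scaleTime r)) := by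
  ext s
  simp only [ContinuousMap.comp_apply, ContinuousMap.smul_apply, primitive_apply, coe_scaleTime]
  have h : EqOn (extendTime (u.comp (scaleTime r))) (fun σ => extendTime u (r * σ))
      (uIcc 0 (s : ℝ)) := by
    intro σ hσ
    have hσ' : σ ∈ timeInterval :=
      (ordConnected_Icc.uIcc_subset (by norm_num) s.2) hσ
    lift σ to timeInterval using hσ'
    simp only [extendTime_coe, ContinuousMap.comp_apply]
    rw [← coe_scaleTime, extendTime_coe]
  rw [intervalIntegral.integral_congr h, intervalIntegral.smul_integral_comp_mul_left]
  simp

/-- The map `(p, ε, u) ↦ (p, ε, u - p - ε ∫ f ∘ u)`, whose third component vanishes exactly when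
`u` is the integral curve of `ε f` starting at `p`. -/
def flowEquation (f : C(E, E)) (q : (E × ℝ) × C(timeInterval, E)) :
    (E × ℝ) × C(timeInterval, E) :=
  (q.1, q.2 - ContinuousMap.const _ q.1.1 - q.1.2 • primitive E (f.comp q.2))

lemma contDiff_flowEquation (f : C(E, E)) (hf : ContDiff ℝ ∞ f) :
    ContDiff ℝ ∞ (flowEquation f) := by
  have hN := contDiff_postcomp (K := timeInterval) f hf
  have hconst : ContDiff ℝ ∞ (fun p : E => ContinuousMap.const timeInterval p) :=
    (ContinuousLinearMap.const ℝ timeInterval : E →L[ℝ] C(timeInterval, E)).contDiff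
  refine contDiff_fst.prodMk ((contDiff_snd.sub (hconst.comp (contDiff_fst.comp contDiff_fst))).sub
    ((contDiff_snd.comp contDiff_fst).smul ((primitive E).contDiff.comp (hN.comp contDiff_snd))))



/-- The derivative of `flowEquation` at a constant curve and zero time. -/
def flowEquationDeriv (w : C(timeInterval, E)) :
    ((E × ℝ) × C(timeInterval, E)) ≃L[ℝ] ((E × ℝ) × C(timeInterval, E)) :=
  let A : E × ℝ →L[ℝ] C(timeInterval, E) :=
    (ContinuousLinearMap.const ℝ timeInterval).comp (ContinuousLinearMap.fst ℝ E ℝ) +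
      (ContinuousLinearMap.snd ℝ E ℝ).smulRight w
  ContinuousLinearEquiv.equivOfInverse
    ((ContinuousLinearMap.fst ℝ _ _).prod
      (ContinuousLinearMap.snd ℝ _ _ - A.comp (ContinuousLinearMap.fst ℝ _ _)))
    ((ContinuousLinearMap.fst ℝ _ _).prod
      (ContinuousLinearMap.snd ℝ _ _ + A.comp (ContinuousLinearMap.fst ℝ _ _)))
    (fun _ => by simp) (fun _ => by simp)

/-- At time factor `0` the derivative of `u ↦ ∫ f ∘ u` is multiplied by zero. What remains is
triangular, hence invertible without any smallness condition on `f`. -/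
lemma hasFDerivAt_flowEquation (f : C(E, E)) (hf : ContDiff ℝ ∞ f) (p : E) :
    HasFDerivAt (flowEquation f)
      (flowEquationDeriv (primitive E (ContinuousMap.const timeInterval (f p))) :
        ((E × ℝ) × C(timeInterval, E)) →L[ℝ] ((E × ℝ) × C(timeInterval, E)))
      ((p, (0 : ℝ)), ContinuousMap.const timeInterval p) := by
  have hN := ((contDiff_postcomp (K := timeInterval) f hf).differentiable (by simp)
    (ContinuousMap.const timeInterval p)).hasFDerivAt
  have h1 : HasFDerivAt (fun q : (E × ℝ) × C(timeInterval, E) => primitive E (f.comp q.2))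
      _ ((p, (0 : ℝ)), ContinuousMap.const timeInterval p) :=
    (primitive E).hasFDerivAt.comp _ (HasFDerivAt.comp (𝕜 := ℝ)
      (g := fun v : C(timeInterval, E) => f.comp v) _ hN hasFDerivAt_snd)
  have h2 : HasFDerivAt (fun q : (E × ℝ) × C(timeInterval, E) => q.1.2)
      ((ContinuousLinearMap.snd ℝ E ℝ).comp (ContinuousLinearMap.fst ℝ _ _))
      ((p, (0 : ℝ)), ContinuousMap.const timeInterval p) :=
    ((ContinuousLinearMap.snd ℝ E ℝ).comp
      (ContinuousLinearMap.fst ℝ (E × ℝ) C(timeInterval, E))).hasFDerivAt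
  have h3 : HasFDerivAt (fun q : (E × ℝ) × C(timeInterval, E) =>
      q.2 - ContinuousMap.const timeInterval q.1.1)
      (ContinuousLinearMap.snd ℝ _ _ - (ContinuousLinearMap.const ℝ timeInterval).comp
        ((ContinuousLinearMap.fst ℝ E ℝ).comp (ContinuousLinearMap.fst ℝ _ _)))
      ((p, (0 : ℝ)), ContinuousMap.const timeInterval p) :=
    (ContinuousLinearMap.snd ℝ (E × ℝ) C(timeInterval, E) -
      (ContinuousLinearMap.const ℝ timeInterval).comp
        ((ContinuousLinearMap.fst ℝ E ℝ).comp (ContinuousLinearMap.fst ℝ _ _))).hasFDerivAt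
  refine (hasFDerivAt_fst.prodMk (h3.sub (h2.smul h1))).congr_fderiv ?_
  ext q s <;> simp [flowEquationDeriv]

variable [CompleteSpace E]

lemma hasDerivAt_primitive (u : C(timeInterval, E)) (s : ℝ) :
    HasDerivAt (fun s => ∫ σ in (0 : ℝ)..s, extendTime u σ) (extendTime u s) s :=
  (continuous_extendTime u).integral_hasStrictDerivAt 0 s |>.hasDerivAt

/-- A smooth map with invertible derivative at a point has a local inverse that is smooth on a
neighbourhood. -/
lemma exists_smooth_localInverse {F : Type*} [NormedAddCommGroup F] [NormedSpace ℝ F]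
    {Φ : E → F} (hΦ : ContDiff ℝ ∞ Φ) {a : E} (A : E ≃L[ℝ] F)
    (hA : HasFDerivAt Φ (A : E →L[ℝ] F) a) :
    ∃ e : OpenPartialHomeomorph E F, a ∈ e.source ∧ (e : E → F) = Φ ∧
      ContDiffOn ℝ ∞ e.symm e.target := by
  let e₀ := hΦ.contDiffAt.toOpenPartialHomeomorph Φ hA (by simp)
  -- Smoothness of the inverse at the single image point would not give one neighbourhood serving
  -- all finite orders. Invertibility of the derivative is an open condition, so after restriction
  -- the inverse is smooth at every point of the target.
  have hinv : ∀ᶠ b in 𝓝 a, fderiv ℝ Φ b ∈ range ((↑) : (E ≃L[ℝ] F) → E →L[ℝ] F) := by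
    have hc : ContinuousAt (fderiv ℝ Φ) a := (hΦ.continuous_fderiv (by simp)).continuousAt
    exact hc.eventually_mem (by rw [hA.fderiv]; exact ContinuousLinearEquiv.nhds A)
  obtain ⟨U, hU, hUo, haU⟩ := _root_.eventually_nhds_iff.1 hinv
  refine ⟨e₀.restrOpen U hUo, ⟨?_, haU⟩, rfl, fun z hz => ContDiffAt.contDiffWithinAt ?_⟩
  · exact hΦ.contDiffAt.mem_toOpenPartialHomeomorph_source hA (by simp)
  · have hz' := (e₀.restrOpen U hUo).map_target hz
    obtain ⟨B, hB⟩ := hU _ hz'.2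
    refine (e₀.restrOpen U hUo).contDiffAt_symm (f₀' := B) hz ?_ hΦ.contDiffAt
    rw [hB]
    exact (hΦ.differentiable (by simp) _).hasFDerivAt

/-- A smooth vector field has a local flow that is jointly smooth in the starting point and the
time. -/
theorem exists_smooth_localFlow (f : E → E) (hf : ContDiff ℝ ∞ f) (p₀ : E) :
    ∃ φ : E × ℝ → E, ∃ ε > 0, ContDiffOn ℝ ∞ φ (ball p₀ ε ×ˢ ball 0 ε) ∧
      ∀ p ∈ ball p₀ ε, φ (p, 0) = p ∧
        ∀ t ∈ ball (0 : ℝ) ε, HasDerivAt (fun t => φ (p, t)) (f (φ (p, t))) t := by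
  let fc : C(E, E) := ⟨f, hf.continuous⟩
  let one : timeInterval := ⟨1, by norm_num⟩
  obtain ⟨e, he₀, hee, hsm⟩ := exists_smooth_localInverse (contDiff_flowEquation fc hf)
    (flowEquationDeriv _) (hasFDerivAt_flowEquation fc hf p₀)
  have hval : flowEquation fc ((p₀, 0), ContinuousMap.const _ p₀) = ((p₀, 0), 0) := by
    simp [flowEquation]
  -- the source contains a ball in the curve variable
  obtain ⟨r, hr, hsrc⟩ := Metric.isOpen_iff.1 e.open_source _ he₀
  have htgt : ((p₀, (0 : ℝ)), (0 : C(timeInterval, E))) ∈ e.target := by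
    rw [← hval, ← hee]
    exact e.map_source he₀
  have hsymm₀ : e.symm ((p₀, 0), 0) = ((p₀, 0), ContinuousMap.const _ p₀) := by
    rw [← hval, ← hee]
    exact e.left_inv he₀
  let ι : E × ℝ → (E × ℝ) × C(timeInterval, E) := fun q => (q, 0)
  have hι : Continuous ι := by fun_prop
  let S : E × ℝ → C(timeInterval, E) := fun q => (e.symm (ι q)).2
  have hev : ∀ᶠ q in 𝓝 (p₀, (0 : ℝ)), ι q ∈ e.target ∧
      e.symm (ι q) ∈ ball ((p₀, (0 : ℝ)), ContinuousMap.const timeInterval p₀) r := by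
    refine (hι.continuousAt.eventually_mem (e.open_target.mem_nhds htgt)).and ?_
    have hcont : ContinuousAt (fun q => e.symm (ι q)) (p₀, (0 : ℝ)) :=
      ContinuousAt.comp (g := e.symm) (e.continuousAt_symm htgt) hι.continuousAt
    refine hcont.eventually_mem ?_
    change ball _ r ∈ 𝓝 (e.symm ((p₀, 0), 0))
    rw [hsymm₀]
    exact ball_mem_nhds _ hr
  have hright : ∀ q, ι q ∈ e.target → e.symm (ι q) = (q, S q) ∧
      S q = ContinuousMap.const _ q.1 + q.2 • primitive E (fc.comp (S q)) := by
    intro q hq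
    have h := e.right_inv hq
    rw [hee] at h
    have h1 : (e.symm (ι q)).1 = q := congrArg Prod.fst h
    have h2 := congrArg Prod.snd h
    refine ⟨Prod.ext h1 rfl, ?_⟩
    simp only [flowEquation, h1, ι] at h2
    rw [sub_sub, sub_eq_zero] at h2
    exact h2
  -- Injectivity of the local homeomorphism: among curves close to the constant `p₀`, the integral
  -- equation has only the solution `S q`.
  have huniq : ∀ q v, (q, v) ∈ ball ((p₀, (0 : ℝ)), ContinuousMap.const timeInterval p₀) r →
      v = ContinuousMap.const _ q.1 + q.2 • primitive E (fc.comp v) → v = S q := by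
    intro q v hqv hv
    have h := e.left_inv (hsrc hqv)
    rw [hee] at h
    have h' : flowEquation fc (q, v) = ι q := by
      refine Prod.ext rfl ?_
      change v - ContinuousMap.const _ q.1 - q.2 • primitive E (fc.comp v) = 0
      rw [sub_sub, sub_eq_zero]
      exact hv
    rw [h'] at h
    exact (congrArg Prod.snd h).symm
  obtain ⟨ε', hε', hgood⟩ := Metric.eventually_nhds_iff_ball.1 hev
  have hgood' : ∀ p ∈ ball p₀ ε', ∀ t ∈ ball (0 : ℝ) ε', ι (p, t) ∈ e.target ∧
      e.symm (ι (p, t)) ∈ ball ((p₀, (0 : ℝ)), ContinuousMap.const timeInterval p₀) r :=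
    fun p hp t ht => hgood (p, t) (by rw [← ball_prod_same]; exact ⟨hp, ht⟩)
  have hε : ε' / 2 < ε' := half_lt_self hε'
  have hmem : ε' / 2 ∈ ball (0 : ℝ) ε' := by
    rw [mem_ball_zero_iff, Real.norm_of_nonneg (by positivity)]
    exact hε
  -- Both sides solve the integral equation for time factor `ρ * (ε' / 2)` and stay close to `p₀`,
  -- so they agree. Thus the single curve `S (p, ε' / 2)` contains the values of the flow at all
  -- times up to `ε' / 2` in absolute value.
  have hscale : ∀ p ∈ ball p₀ ε', ∀ ρ : timeInterval,
      S (p, ρ * (ε' / 2)) = (S (p, ε' / 2)).comp (scaleTime ρ) := by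
    intro p hp ρ
    obtain ⟨ht, hb⟩ := hgood' p hp _ hmem
    obtain ⟨h1, h2⟩ := hright _ ht
    rw [h1, mem_ball, Prod.dist_eq, Prod.dist_eq, max_lt_iff, max_lt_iff] at hb
    symm
    refine huniq _ _ ?_ ?_
    · rw [mem_ball, Prod.dist_eq, Prod.dist_eq, max_lt_iff, max_lt_iff]
      refine ⟨⟨hb.1.1, lt_of_le_of_lt ?_ hb.1.2⟩, lt_of_le_of_lt ?_ hb.2⟩
      · simp only [dist_zero_right, norm_mul]
        exact mul_le_of_le_one_left (norm_nonneg _) (abs_le.2 ρ.2)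
      · exact (ContinuousMap.dist_le dist_nonneg).2 fun s =>
          ContinuousMap.dist_apply_le_dist (f := S (p, ε' / 2))
            (g := ContinuousMap.const timeInterval p₀) (scaleTime ρ s)
    · have h3 := primitive_comp_scaleTime (fc.comp (S (p, ε' / 2))) ρ
      ext s
      have h4 := DFunLike.congr_fun h2 (scaleTime ρ s)
      have h5 := DFunLike.congr_fun h3 s
      simp only [ContinuousMap.comp_apply, ContinuousMap.add_apply, ContinuousMap.const_apply,
        ContinuousMap.smul_apply] at h4 h5 ⊢
      rw [h4, h5, smul_smul, mul_comm, ContinuousMap.comp_assoc]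
  refine ⟨fun q => S q one, ε' / 2, by positivity, ?_, fun p hp => ⟨?_, fun t ht => ?_⟩⟩
  · have hS : ContDiffOn ℝ ∞ (fun q => e.symm (ι q)) (ball p₀ (ε' / 2) ×ˢ ball 0 (ε' / 2)) := by
      refine hsm.comp (contDiff_id.prodMk contDiff_const).contDiffOn fun q hq => ?_
      exact (hgood' q.1 (ball_subset_ball hε.le hq.1) q.2 (ball_subset_ball hε.le hq.2)).1
    exact (ContinuousMap.evalCLM ℝ one).contDiff.comp_contDiffOn (contDiff_snd.comp_contDiffOn hS)
  · obtain ⟨-, h⟩ := hright _ (hgood' p (ball_subset_ball hε.le hp) 0 (mem_ball_self hε')).1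
    simpa using DFunLike.congr_fun h one
  · have hp' := ball_subset_ball hε.le hp
    obtain ⟨-, h⟩ := hright _ (hgood' p hp' _ hmem).1
    -- The flow at time `t` is the endpoint of `S (p, t)`, that is, the value of the reference curve
    -- at `t / (ε' / 2)`. In this form its time derivative follows from the fundamental theorem of
    -- calculus.
    have hform : ∀ t ∈ ball (0 : ℝ) (ε' / 2), extendTime (S (p, ε' / 2)) (t / (ε' / 2)) =
        S (p, t) one ∧ S (p, t) one = p + (ε' / 2) • ∫ σ in (0 : ℝ)..(t / (ε' / 2)),
          extendTime (fc.comp (S (p, ε' / 2))) σ := by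
      intro t ht
      have hρ : t / (ε' / 2) ∈ timeInterval := by
        refine abs_le.1 ?_
        rw [abs_div, abs_of_pos (half_pos hε'), div_le_one (half_pos hε')]
        exact (mem_ball_zero_iff.1 ht).le
      have h6 := DFunLike.congr_fun (hscale p hp' ⟨_, hρ⟩) one
      rw [div_mul_cancel₀ _ (half_pos hε').ne'] at h6
      have h7 : scaleTime ⟨_, hρ⟩ one = ⟨_, hρ⟩ := Subtype.ext (by simp [one])
      rw [ContinuousMap.comp_apply, h7] at h6
      refine ⟨by rw [h6]; exact extendTime_coe _ ⟨_, hρ⟩, ?_⟩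
      rw [h6]
      exact DFunLike.congr_fun h ⟨_, hρ⟩
    have hd := (((hasDerivAt_primitive (fc.comp (S (p, ε' / 2))) (t / (ε' / 2))).scomp t
      ((hasDerivAt_id t).div_const (ε' / 2))).const_smul (ε' / 2)).const_add p
    have hd' : HasDerivAt (fun t => p + (ε' / 2) • ∫ σ in (0 : ℝ)..(t / (ε' / 2)),
        extendTime (fc.comp (S (p, ε' / 2))) σ) (f (S (p, t) one)) t := by
      refine hd.congr_deriv ?_
      rw [smul_smul, mul_one_div_cancel (half_pos hε').ne', one_smul, ← (hform t ht).1]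
      rfl
    refine hd'.congr_of_eventuallyEq ?_
    filter_upwards [isOpen_ball.mem_nhds ht] with τ hτ using (hform τ hτ).2

end Flow

/-! ### Left logarithmic derivatives and uniqueness -/

section LogarithmicDerivative

variable {E : Type*} [NormedAddCommGroup E] [NormedSpace ℝ E]
  {H : Type*} [TopologicalSpace H] [ChartedSpace E H] [Group H]

/-- The preferred chart at the identity, as a map to the model space. -/
abbrev oneChart (E H : Type*) [NormedAddCommGroup E] [NormedSpace ℝ E]
    [TopologicalSpace H] [ChartedSpace E H] [Group H] : PartialEquiv H E :=
  extChartAt 𝓘(ℝ, E) (1 : H)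

/-- The differential at `p` of a map sending `p` to `1` is its differential in the chart at `1`. -/
lemma hasMFDerivAt_iff_of_eq_one {F : Type*} [NormedAddCommGroup F] [NormedSpace ℝ F]
    {g : F → H} {p : F} (h1 : g p = 1) (L : F →L[ℝ] E) :
    HasMFDerivAt 𝓘(ℝ, F) 𝓘(ℝ, E) g p L ↔
      ContinuousAt g p ∧ HasFDerivAt (fun q => oneChart E H (g q)) L p := by
  refine and_congr_right fun _ => ?_
  simp only [writtenInExtChartAt, h1, mfld_simps]
  exact hasFDerivWithinAt_univ (E := F) (F := E)

lemma hasFDerivAt_oneChart_comp {F : Type*} [NormedAddCommGroup F] [NormedSpace ℝ F]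
    {g : F → H} {p : F} (hg : MDifferentiableAt 𝓘(ℝ, F) 𝓘(ℝ, E) g p) (h1 : g p = 1) :
    HasFDerivAt (F := E) (fun q => oneChart E H (g q))
      (mfderiv 𝓘(ℝ, F) 𝓘(ℝ, E) g p : F →L[ℝ] E) p :=
  ((hasMFDerivAt_iff_of_eq_one h1 _).1 hg.hasMFDerivAt).2

lemma leftLogDeriv_congr {γ γ' : ℝ → H} {s : ℝ} (h : γ =ᶠ[𝓝 s] γ') :
    leftLogDeriv (E := E) γ s = leftLogDeriv (E := E) γ' s := by
  unfold leftLogDeriv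
  rw [h.mfderiv_eq, h.eq_of_nhds]

lemma contMDiffAt_oneChart_symm [IsManifold 𝓘(ℝ, E) ∞ H] {z : E}
    (hz : z ∈ (oneChart E H).target) :
    ContMDiffAt 𝓘(ℝ, E) 𝓘(ℝ, E) ∞ (oneChart E H).symm z :=
  (contMDiffOn_extChartAt_symm (n := ∞) (1 : H)).contMDiffAt
    ((isOpen_extChartAt_target (1 : H)).mem_nhds hz)

/-- A smooth map into `H` is smooth when read in the chart at `1`. -/
lemma contDiffAt_oneChart_comp [IsManifold 𝓘(ℝ, E) ∞ H]
    {F : Type*} [NormedAddCommGroup F] [NormedSpace ℝ F]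
    {g : F → H} {p : F} (hg : ContMDiffAt 𝓘(ℝ, F) 𝓘(ℝ, E) ∞ g p)
    (hp : g p ∈ (oneChart E H).source) :
    ContDiffAt ℝ ∞ (fun q => oneChart E H (g q)) p := by
  have h : ContMDiffAt 𝓘(ℝ, E) 𝓘(ℝ, E) ∞ (oneChart E H) (g p) :=
    contMDiffAt_extChartAt' (by rwa [← extChartAt_source 𝓘(ℝ, E)])
  exact (h.comp p hg).contDiffAt

lemma oneChart_one_mem_target : oneChart E H 1 ∈ (oneChart E H).target :=
  mem_extChartAt_target (1 : H)

lemma oneChart_symm_one : (oneChart E H).symm (oneChart E H 1) = 1 :=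
  extChartAt_to_inv (1 : H)

lemma oneChart_one_mem_source : (1 : H) ∈ (oneChart E H).source :=
  mem_extChartAt_source (1 : H)

lemma oneChart_source_mem_nhds {a : H} (ha : a ∈ (oneChart E H).source) :
    (oneChart E H).source ∈ 𝓝 a :=
  (isOpen_extChartAt_source (1 : H)).mem_nhds ha

variable [LieGroup 𝓘(ℝ, E) ∞ H]

lemma mdifferentiable_mul_left_const (a : H) :
    MDifferentiable 𝓘(ℝ, E) 𝓘(ℝ, E) (fun h : H => a * h) :=
  (contMDiff_mul_left (I := 𝓘(ℝ, E)) (n := ∞)).mdifferentiable (by simp)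

lemma leftLogDeriv_eq_mfderiv {γ : ℝ → H} {s : ℝ}
    (hγ : MDifferentiableAt 𝓘(ℝ, ℝ) 𝓘(ℝ, E) γ s) :
    (leftLogDeriv (E := E) γ s : E) =
      (mfderiv 𝓘(ℝ, ℝ) 𝓘(ℝ, E) (fun s' => (γ s)⁻¹ * γ s') s : ℝ →L[ℝ] E) 1 := by
  have h := mfderiv_comp (I := 𝓘(ℝ, ℝ)) (I' := 𝓘(ℝ, E)) (I'' := 𝓘(ℝ, E)) s
    (g := fun h : H => (γ s)⁻¹ * h) (f := γ) (mdifferentiable_mul_left_const (E := E) _ _) hγ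
  exact (DFunLike.congr_fun h (1 : ℝ)).symm

/-- The left logarithmic derivative, computed in the chart at the identity. -/
lemma hasDerivAt_oneChart {γ : ℝ → H} {s : ℝ}
    (hγ : MDifferentiableAt 𝓘(ℝ, ℝ) 𝓘(ℝ, E) γ s) :
    HasDerivAt (F := E) (fun s' => oneChart E H ((γ s)⁻¹ * γ s'))
      (leftLogDeriv (E := E) γ s) s := by
  rw [leftLogDeriv_eq_mfderiv hγ]
  exact HasFDerivAt.hasDerivAt (F := E) (hasFDerivAt_oneChart_comp
    ((mdifferentiable_mul_left_const (E := E) _ _).comp s hγ) (inv_mul_cancel _))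

lemma leftLogDeriv_mul_left (a : H) {γ : ℝ → H} {s : ℝ}
    (hγ : MDifferentiableAt 𝓘(ℝ, ℝ) 𝓘(ℝ, E) γ s) :
    leftLogDeriv (E := E) (fun s => a * γ s) s = leftLogDeriv (E := E) γ s := by
  have h1 := hasDerivAt_oneChart ((mdifferentiable_mul_left_const (E := E) a _).comp s hγ)
  have h2 := hasDerivAt_oneChart hγ
  refine h1.unique (h2.congr_of_eventuallyEq (.of_forall fun s' => ?_))
  simp [mul_assoc]

/-- Two curves with the same left logarithmic derivative at `s` have a quotient with vanishing
derivative at `s`. -/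
lemma hasMFDerivAt_mul_inv_zero {γ γ' : ℝ → H} {s : ℝ}
    (hγ : MDifferentiableAt 𝓘(ℝ, ℝ) 𝓘(ℝ, E) γ s) (hγ' : MDifferentiableAt 𝓘(ℝ, ℝ) 𝓘(ℝ, E) γ' s)
    (h : leftLogDeriv (E := E) γ s = leftLogDeriv (E := E) γ' s) :
    HasMFDerivAt 𝓘(ℝ, ℝ) 𝓘(ℝ, E) (fun s => γ s * (γ' s)⁻¹) s 0 := by
  let α : ℝ → H := fun s' => (γ s)⁻¹ * γ s'
  let β : ℝ → H := fun s' => (γ' s)⁻¹ * γ' s'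
  have hα1 : α s = 1 := inv_mul_cancel _
  have hβ1 : β s = 1 := inv_mul_cancel _
  have hα : MDifferentiableAt 𝓘(ℝ, ℝ) 𝓘(ℝ, E) α s :=
    (mdifferentiable_mul_left_const (E := E) _ _).comp s hγ
  have hβ : MDifferentiableAt 𝓘(ℝ, ℝ) 𝓘(ℝ, E) β s :=
    (mdifferentiable_mul_left_const (E := E) _ _).comp s hγ'
  have : IsTopologicalGroup H := topologicalGroup_of_lieGroup 𝓘(ℝ, E) ∞
  have hαc : ContinuousAt α s := hα.continuousAt
  have hβc : ContinuousAt β s := hβ.continuousAt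
  -- the difference map in the chart at `1`
  let D : E × E → E := fun p =>
    oneChart E H ((oneChart E H).symm p.1 * ((oneChart E H).symm p.2)⁻¹)
  let e := oneChart E H 1
  have hD : DifferentiableAt ℝ D (e, e) := by
    have h1 : ContMDiffAt 𝓘(ℝ, E × E) 𝓘(ℝ, E) ∞ (fun p : E × E => (oneChart E H).symm p.1)
        (e, e) := ContMDiffAt.comp (e, e) (g := (oneChart E H).symm)
      (contMDiffAt_oneChart_symm oneChart_one_mem_target) contDiff_fst.contMDiff.contMDiffAt
    have h2 : ContMDiffAt 𝓘(ℝ, E × E) 𝓘(ℝ, E) ∞ (fun p : E × E => (oneChart E H).symm p.2)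
        (e, e) := ContMDiffAt.comp (e, e) (g := (oneChart E H).symm)
      (contMDiffAt_oneChart_symm oneChart_one_mem_target) contDiff_snd.contMDiff.contMDiffAt
    refine (contDiffAt_oneChart_comp (h1.mul h2.inv) ?_).differentiableAt (by simp)
    simp only [Pi.mul_apply, e, oneChart_symm_one, mul_inv_cancel, oneChart_one_mem_source]
  -- `D` represents `(a, b) ↦ a b⁻¹`, which is constant on the diagonal; its derivative therefore
  -- kills pairs of equal velocities.
  have hdiag : ∀ v, fderiv ℝ D (e, e) (v, v) = 0 := by
    intro v
    have h1 : HasFDerivAt (fun z : E => D (z, z))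
        ((fderiv ℝ D (e, e)).comp ((ContinuousLinearMap.id ℝ E).prod (.id ℝ E))) e :=
      HasFDerivAt.comp (g := D) e hD.hasFDerivAt ((hasFDerivAt_id e).prodMk (hasFDerivAt_id e))
    have h2 : HasFDerivAt (fun z : E => D (z, z)) (0 : E →L[ℝ] E) e := by
      simp only [D, mul_inv_cancel]
      exact hasFDerivAt_const _ _
    exact DFunLike.congr_fun (h1.unique h2) v
  have hquot : HasDerivAt (fun s' => oneChart E H (α s' * (β s')⁻¹)) (0 : E) s := by
    have h1 := hasDerivAt_oneChart hγ
    have h2 := hasDerivAt_oneChart hγ'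
    rw [h] at h1
    have h3 : HasFDerivAt D (fderiv ℝ D (e, e)) (oneChart E H (α s), oneChart E H (β s)) := by
      rw [hα1, hβ1]
      exact hD.hasFDerivAt
    have h4 := h3.comp_hasDerivAt s (HasDerivAt.prodMk (F := E) (G := E) h1 h2)
    refine (h4.congr_deriv (hdiag _)).congr_of_eventuallyEq ?_
    have hs : (oneChart E H).source ∈ 𝓝 (1 : H) := oneChart_source_mem_nhds oneChart_one_mem_source
    filter_upwards [hαc.eventually_mem (hα1 ▸ hs), hβc.eventually_mem (hβ1 ▸ hs)] with s' ha hb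
    change _ = D (oneChart E H (α s'), oneChart E H (β s'))
    simp only [D, PartialEquiv.left_inv _ ha, PartialEquiv.left_inv _ hb]
  have hquot' : HasMFDerivAt 𝓘(ℝ, ℝ) 𝓘(ℝ, E) (fun s' => α s' * (β s')⁻¹) s (0 : ℝ →L[ℝ] E) := by
    refine (hasMFDerivAt_iff_of_eq_one (by simp [hα1, hβ1]) _).2 ⟨hαc.mul hβc.inv, ?_⟩
    simpa using hquot.hasFDerivAt
  -- Multiplying by `γ s` on the left and by `(γ' s)⁻¹` on the right carries the quotient of the
  -- curves through `1` to the original quotient.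
  have hsm : MDifferentiable 𝓘(ℝ, E) 𝓘(ℝ, E) (fun h : H => γ s * (h * (γ' s)⁻¹)) :=
    ((contMDiff_mul_left (I := 𝓘(ℝ, E)) (n := ∞)).comp
      (contMDiff_mul_right (I := 𝓘(ℝ, E)) (n := ∞))).mdifferentiable (by simp)
  have h5 := (hsm (α s * (β s)⁻¹)).hasMFDerivAt.comp s hquot'
  have h6 : (fun h : H => γ s * (h * (γ' s)⁻¹)) ∘ (fun s' => α s' * (β s')⁻¹) =
      fun s => γ s * (γ' s)⁻¹ := by
    funext s'
    simp [α, β, mul_assoc]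
  rw [h6] at h5
  exact h5.congr_mfderiv (ContinuousLinearMap.comp_zero _)

/-- A curve in a manifold whose derivative vanishes on an open interval is constant there. -/
lemma eqOn_const_of_hasMFDerivAt_zero {M : Type*} [TopologicalSpace M] [ChartedSpace E M]
    [IsManifold 𝓘(ℝ, E) 1 M]
    {δ : ℝ → M} {I : Set ℝ} (hI : IsOpen I) (hIc : IsPreconnected I)
    (h : ∀ s ∈ I, HasMFDerivAt 𝓘(ℝ, ℝ) 𝓘(ℝ, E) δ s (0 : ℝ →L[ℝ] E)) {s₀ s : ℝ}
    (hs₀ : s₀ ∈ I) (hs : s ∈ I) : δ s = δ s₀ := by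
  refine hIc.induction₂ (fun a b => δ b = δ a) (fun a ha => ?_)
    (fun _ _ _ _ _ _ h₁ h₂ => h₂.trans h₁) (fun _ _ _ _ h => h.symm) hs₀ hs
  refine mem_nhdsWithin_of_mem_nhds ?_
  obtain ⟨r, hr, hball⟩ := Metric.mem_nhds_iff.1 (inter_mem (hI.mem_nhds ha)
    ((h a ha).1.preimage_mem_nhds (extChartAt_source_mem_nhds (I := 𝓘(ℝ, E)) (δ a))))
  filter_upwards [ball_mem_nhds a hr] with b hb
  have hder : ∀ c ∈ ball a r,
      HasFDerivAt (fun s => extChartAt 𝓘(ℝ, E) (δ a) (δ s)) (0 : ℝ →L[ℝ] E) c := by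
    intro c hc
    have hcs := (hball hc).2
    have h1 := ((mdifferentiableAt_extChartAt (I := 𝓘(ℝ, E))
      (by rwa [← extChartAt_source 𝓘(ℝ, E)])).hasMFDerivAt.comp c (h c (hball hc).1))
    exact HasMFDerivAt.hasFDerivAt (h1.congr_mfderiv (ContinuousLinearMap.comp_zero _))
  have hconst := (convex_ball a r).is_const_of_fderivWithin_eq_zero (𝕜 := ℝ)
    (f := fun s => extChartAt 𝓘(ℝ, E) (δ a) (δ s))
    (fun c hc => (hder c hc).differentiableAt.differentiableWithinAt)
    (fun c hc => by
      rw [fderivWithin_of_isOpen isOpen_ball hc]; exact (hder c hc).fderiv)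
    hb (mem_ball_self hr)
  exact (extChartAt 𝓘(ℝ, E) (δ a)).injOn (hball hb).2 (hball (mem_ball_self hr)).2 hconst

/-- Curves in a Lie group with the same left logarithmic derivative on an open interval differ by
a left translation. -/
lemma eq_mul_of_leftLogDeriv_eq {γ γ' : ℝ → H} {I : Set ℝ} (hI : IsOpen I) (hIc : IsPreconnected I)
    (hγ : ∀ s ∈ I, MDifferentiableAt 𝓘(ℝ, ℝ) 𝓘(ℝ, E) γ s)
    (hγ' : ∀ s ∈ I, MDifferentiableAt 𝓘(ℝ, ℝ) 𝓘(ℝ, E) γ' s)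
    (h : ∀ s ∈ I, leftLogDeriv (E := E) γ s = leftLogDeriv (E := E) γ' s)
    {s₀ s : ℝ} (hs₀ : s₀ ∈ I) (hs : s ∈ I) : γ s = γ s₀ * (γ' s₀)⁻¹ * γ' s := by
  have : IsManifold 𝓘(ℝ, E) 1 H := IsManifold.of_le (n := ∞) (by simp)
  have h1 := eqOn_const_of_hasMFDerivAt_zero hI hIc
    (fun s hs => hasMFDerivAt_mul_inv_zero (hγ s hs) (hγ' s hs) (h s hs)) hs₀ hs
  rw [← h1, inv_mul_cancel_right]

lemma SolvesLeftLog.unique {ξ : ℝ → GroupLieAlgebra 𝓘(ℝ, E) H} {s₀ : ℝ} {γ γ' : ℝ → H}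
    (h : SolvesLeftLog (E := E) ξ s₀ γ) (h' : SolvesLeftLog (E := E) ξ s₀ γ') : γ = γ' := by
  funext s
  have := eq_mul_of_leftLogDeriv_eq (E := E) isOpen_univ isPreconnected_univ (fun s _ => h.1 s)
    (fun s _ => h'.1 s) (fun s _ => (h.2.1 s).trans (h'.2.1 s).symm) (mem_univ s₀) (mem_univ s)
  rwa [h.2.2, h'.2.2, inv_one, mul_one, one_mul] at this

end LogarithmicDerivative

/-! ### The differentiated action on the Lie algebra -/

section Action

variable {EG : Type*} [NormedAddCommGroup EG] [NormedSpace ℝ EG]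
  {G : Type*} [TopologicalSpace G] [ChartedSpace EG G] [Group G] [LieGroup 𝓘(ℝ, EG) ∞ G]
  {EH : Type*} [NormedAddCommGroup EH] [NormedSpace ℝ EH]
  {H : Type*} [TopologicalSpace H] [ChartedSpace EH H] [Group H] [LieGroup 𝓘(ℝ, EH) ∞ H]
  (X : LieCrossedModule EG G EH H)

namespace LieCrossedModule

lemma contMDiff_action {P EP : Type*} [NormedAddCommGroup EP] [NormedSpace ℝ EP]
    [TopologicalSpace P] [ChartedSpace EP P] {a : P → G} {h : P → H}
    (ha : ContMDiff 𝓘(ℝ, EP) 𝓘(ℝ, EG) ∞ a) (hh : ContMDiff 𝓘(ℝ, EP) 𝓘(ℝ, EH) ∞ h) :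
    ContMDiff 𝓘(ℝ, EP) 𝓘(ℝ, EH) ∞ (fun p => X.m (a p) (h p)) :=
  X.contMDiff_m.comp (ha.prodMk hh)

lemma mdifferentiable_m (a : G) : MDifferentiable 𝓘(ℝ, EH) 𝓘(ℝ, EH) (fun h : H => X.m a h) :=
  (X.contMDiff_action contMDiff_const contMDiff_id).mdifferentiable (by simp)

lemma mDot_neg (a : G) (v : GroupLieAlgebra 𝓘(ℝ, EH) H) : X.mDot a (-v) = -X.mDot a v :=
  ContinuousLinearMap.map_neg (M := EH) (M₂ := EH)
    (mfderiv 𝓘(ℝ, EH) 𝓘(ℝ, EH) (fun h : H => X.m a h) (1 : H)) v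

/-- The differential `ṁ(a)`, computed in the chart at the identity. -/
lemma hasFDerivAt_mDot (a : G) : ∃ A : EH →L[ℝ] EH, (∀ v, A v = X.mDot a v) ∧
    HasFDerivAt (fun z => oneChart EH H (X.m a ((oneChart EH H).symm z))) A
      (oneChart EH H (1 : H)) := by
  refine ⟨mfderiv 𝓘(ℝ, EH) 𝓘(ℝ, EH) (fun h : H => X.m a h) (1 : H), fun v => rfl, ?_⟩
  have h := (X.mdifferentiable_m a 1).hasMFDerivAt.2
  simp only [writtenInExtChartAt, map_one, mfld_simps] at h
  exact (hasFDerivWithinAt_univ (E := EH) (F := EH)).1 h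

/-- `ṁ(a)` sends the logarithmic derivative of a curve to that of its image under `m(a)`. -/
lemma mDot_leftLogDeriv (a : G) {γ : ℝ → H} {s : ℝ}
    (hγ : MDifferentiableAt 𝓘(ℝ, ℝ) 𝓘(ℝ, EH) γ s) :
    X.mDot a (leftLogDeriv (E := EH) γ s) = leftLogDeriv (E := EH) (fun s => X.m a (γ s)) s := by
  obtain ⟨A, hA, hd⟩ := X.hasFDerivAt_mDot a
  have h1 := hasDerivAt_oneChart hγ
  have h2 := hasDerivAt_oneChart (E := EH) ((X.mdifferentiable_m a (γ s)).comp s hγ)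
  refine (hA _).symm.trans ?_
  have h3 : HasFDerivAt (fun z => oneChart EH H (X.m a ((oneChart EH H).symm z))) A
      (oneChart EH H ((γ s)⁻¹ * γ s)) := by
    rwa [inv_mul_cancel]
  refine HasDerivAt.unique (F := EH) ((h3.comp_hasDerivAt s h1).congr_of_eventuallyEq ?_) h2
  have hc : ContinuousAt (fun s' => (γ s)⁻¹ * γ s') s :=
    ((mdifferentiable_mul_left_const (E := EH) _ _).comp s hγ).continuousAt
  filter_upwards [hc.eventually_mem ((inv_mul_cancel (γ s)).symm ▸
    oneChart_source_mem_nhds (E := EH) oneChart_one_mem_source)] with s' hs'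
  simp only [Function.comp_apply, PartialEquiv.left_inv _ hs', map_mul, map_inv]

lemma mDot_one (v : GroupLieAlgebra 𝓘(ℝ, EH) H) : X.mDot (1 : G) v = v := by
  unfold mDot
  have : (fun h : H => X.m (1 : G) h) = id := by funext h; simp
  rw [this, mfderiv_id]
  rfl

/-- The chain rule at `1`, which is fixed by every `m(b)`. -/
lemma mDot_mul (a b : G) (v : GroupLieAlgebra 𝓘(ℝ, EH) H) :
    X.mDot (a * b) v = X.mDot a (X.mDot b v) := by
  obtain ⟨A, hA, hdA⟩ := X.hasFDerivAt_mDot a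
  obtain ⟨B, hB, hdB⟩ := X.hasFDerivAt_mDot b
  obtain ⟨C, hC, hdC⟩ := X.hasFDerivAt_mDot (a * b)
  have h1 : HasFDerivAt (fun z => oneChart EH H (X.m a ((oneChart EH H).symm z))) A
      (oneChart EH H (X.m b ((oneChart EH H).symm (oneChart EH H (1 : H))))) := by
    rwa [oneChart_symm_one, map_one]
  have h2 : C = A.comp B := by
    refine hdC.unique ((HasFDerivAt.comp (oneChart EH H (1 : H)) h1 hdB).congr_of_eventuallyEq ?_)
    have hc : ContinuousAt (fun z => X.m b ((oneChart EH H).symm z)) (oneChart EH H (1 : H)) :=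
      (X.mdifferentiable_m b _).continuousAt.comp
        (contMDiffAt_oneChart_symm oneChart_one_mem_target).continuousAt
    have hone : X.m b ((oneChart EH H).symm (oneChart EH H (1 : H))) = 1 := by
      rw [oneChart_symm_one, map_one]
    filter_upwards [hc.eventually_mem (hone.symm ▸
      oneChart_source_mem_nhds (E := EH) oneChart_one_mem_source)] with z hz
    simp only [Function.comp_apply, PartialEquiv.left_inv _ hz, map_mul, MulAut.mul_apply]
  refine (hC v).symm.trans ?_
  rw [h2]
  exact (hA (B v)).trans (congrArg (X.mDot a) (hB v))

/-- `ṁ(a)(v)` depends smoothly on parameters when `a` and `v` do. -/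
lemma contDiff_mDot {P : Type*} [NormedAddCommGroup P] [NormedSpace ℝ P] {a : P → G} {v : P → EH}
    (ha : ContMDiff 𝓘(ℝ, P) 𝓘(ℝ, EG) ∞ a) (hv : ContDiff ℝ ∞ v) :
    ContDiff ℝ ∞ (F := EH) (fun p => X.mDot (a p) (v p)) := by
  -- In the chart at `1`, `ṁ(a p)` is a partial derivative of a jointly smooth function at a fixed
  -- point, hence smooth in `p`.
  let F : P → EH → EH := fun p z => oneChart EH H (X.m (a p) ((oneChart EH H).symm z))
  have hF : (fun p => X.mDot (a p) (v p)) =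
      fun p => fderiv ℝ (F p) (oneChart EH H (1 : H)) (v p) := by
    funext p
    obtain ⟨A, hA, hd⟩ := X.hasFDerivAt_mDot (a p)
    exact (hA _).symm.trans (congrArg (fun B : EH →L[ℝ] EH => B (v p)) hd.fderiv.symm)
  rw [hF, contDiff_iff_contDiffAt]
  intro p
  refine ContDiffAt.clm_apply (ContDiffAt.fderiv (n := ∞) ?_ contDiffAt_const (by simp))
    hv.contDiffAt
  have h1 : ContMDiffAt 𝓘(ℝ, P × EH) 𝓘(ℝ, EH) ∞
      (fun q : P × EH => (oneChart EH H).symm q.2) (p, oneChart EH H (1 : H)) :=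
    ContMDiffAt.comp (p, oneChart EH H (1 : H)) (g := (oneChart EH H).symm)
      (contMDiffAt_oneChart_symm oneChart_one_mem_target) contDiff_snd.contMDiff.contMDiffAt
  have h2 : ContMDiffAt 𝓘(ℝ, P × EH) 𝓘(ℝ, EG) ∞
      (fun q : P × EH => a q.1) (p, oneChart EH H (1 : H)) :=
    (ha.comp contDiff_fst.contMDiff).contMDiffAt
  refine contDiffAt_oneChart_comp
    (ContMDiffAt.comp (p, oneChart EH H (1 : H)) X.contMDiff_m.contMDiffAt (h2.prodMk h1)) ?_
  simp only [oneChart_symm_one, map_one, oneChart_one_mem_source]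

end LieCrossedModule

end Action

/-! ### Global solutions depending smoothly on a parameter -/

section Existence

/-- A function that is smooth near a point agrees near that point with a globally smooth one. -/
lemma exists_contDiff_eventuallyEq {F F' : Type*} [NormedAddCommGroup F] [NormedSpace ℝ F]
    [FiniteDimensional ℝ F] [NormedAddCommGroup F'] [NormedSpace ℝ F'] {f : F → F'} {U : Set F}
    {p : F} (hU : U ∈ 𝓝 p) (hf : ∀ q ∈ U, ContDiffAt ℝ ∞ f q) :
    ∃ g : F → F', ContDiff ℝ ∞ g ∧ g =ᶠ[𝓝 p] f := by
  obtain ⟨r, hr, hrU⟩ := Metric.nhds_basis_closedBall.mem_iff.1 hU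
  let χ : ContDiffBump p := ⟨r / 2, r, half_pos hr, half_lt_self hr⟩
  refine ⟨fun q => χ q • f q, contDiff_iff_contDiffAt.2 fun q => ?_, ?_⟩
  · by_cases hq : q ∈ closedBall p r
    · exact χ.contDiffAt.smul (hf q (hrU hq))
    · have h0 : (fun q => χ q • f q) =ᶠ[𝓝 q] fun _ => 0 := by
        filter_upwards [isClosed_closedBall.isOpen_compl.mem_nhds hq] with z hz
        have : r ≤ dist z p := by
          simp only [mem_compl_iff, mem_closedBall, not_le] at hz
          exact hz.le
        rw [χ.zero_of_le_dist this, zero_smul]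
      exact contDiffAt_const.congr_of_eventuallyEq h0
  · filter_upwards [χ.eventuallyEq_one] with q hq
    rw [hq, Pi.one_apply, one_smul]

variable {E : Type*} [NormedAddCommGroup E] [NormedSpace ℝ E]
  {H : Type*} [TopologicalSpace H] [ChartedSpace E H] [Group H] [LieGroup 𝓘(ℝ, E) ∞ H]

variable (H) in
/-- The product of the Lie group `H`, read in the chart at the identity. -/
def chartMul (u z : E) : E := oneChart E H ((oneChart E H).symm u * (oneChart E H).symm z)

lemma contDiffAt_chartMul {u : E} (hu : u ∈ (oneChart E H).target) :
    ContDiffAt ℝ ∞ (Function.uncurry (chartMul (E := E) H)) (u, oneChart E H 1) := by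
  have h1 : ContMDiffAt 𝓘(ℝ, E × E) 𝓘(ℝ, E) ∞ (fun p : E × E => (oneChart E H).symm p.1)
      (u, oneChart E H 1) := ContMDiffAt.comp (u, oneChart E H 1) (g := (oneChart E H).symm)
    (contMDiffAt_oneChart_symm hu) contDiff_fst.contMDiff.contMDiffAt
  have h2 : ContMDiffAt 𝓘(ℝ, E × E) 𝓘(ℝ, E) ∞ (fun p : E × E => (oneChart E H).symm p.2)
      (u, oneChart E H 1) := ContMDiffAt.comp (u, oneChart E H 1) (g := (oneChart E H).symm)
    (contMDiffAt_oneChart_symm oneChart_one_mem_target) contDiff_snd.contMDiff.contMDiffAt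
  refine contDiffAt_oneChart_comp (h1.mul h2) ?_
  simp only [oneChart_symm_one, mul_one]
  exact (oneChart E H).map_target hu

/-- The logarithmic derivative of a curve that solves the left invariant differential equation in
the chart at the identity. -/
lemma leftLogDeriv_oneChart_symm {u : ℝ → E} {s : ℝ} {v : E}
    (hu : u s ∈ (oneChart E H).target)
    (hd : HasDerivAt u (fderiv ℝ (chartMul H (u s)) (oneChart E H 1) v) s) :
    leftLogDeriv (E := E) (fun s => (oneChart E H).symm (u s)) s = v := by
  let γ : ℝ → H := fun s => (oneChart E H).symm (u s)
  let e : E := oneChart E H 1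
  have hγ : MDifferentiableAt 𝓘(ℝ, ℝ) 𝓘(ℝ, E) γ s :=
    ((contMDiffAt_oneChart_symm hu).mdifferentiableAt (by simp)).comp s
      hd.differentiableAt.mdifferentiableAt
  -- `C` is left translation by `(γ s)⁻¹` in the chart. Near `e` it undoes `chartMul H (u s)`, so
  -- its derivative carries the velocity of `u` back to `v`.
  let C : E → E := fun z => oneChart E H ((γ s)⁻¹ * (oneChart E H).symm z)
  have hC : DifferentiableAt ℝ C (u s) := by
    have h1 : ContMDiffAt 𝓘(ℝ, E) 𝓘(ℝ, E) ∞ (fun z => (γ s)⁻¹ * (oneChart E H).symm z) (u s) :=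
      ContMDiffAt.comp (u s) contMDiff_mul_left.contMDiffAt (contMDiffAt_oneChart_symm hu)
    refine (contDiffAt_oneChart_comp h1 ?_).differentiableAt (by simp)
    simp only [γ, inv_mul_cancel, oneChart_one_mem_source]
  have hB : DifferentiableAt ℝ (chartMul H (u s)) e := by
    have h := (contDiffAt_chartMul hu).comp e (contDiffAt_const.prodMk contDiffAt_id)
    exact h.differentiableAt (by simp)
  have hBe : chartMul H (u s) e = u s := by
    simp only [chartMul, e, oneChart_symm_one, mul_one]
    exact (oneChart E H).right_inv hu
  have hCB : HasFDerivAt (fun z => C (chartMul H (u s) z))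
      ((fderiv ℝ C (u s)).comp (fderiv ℝ (chartMul H (u s)) e)) e := by
    refine HasFDerivAt.comp (g := C) e ?_ hB.hasFDerivAt
    rw [hBe]
    exact hC.hasFDerivAt
  have hid : (fun z => C (chartMul H (u s) z)) =ᶠ[𝓝 e] id := by
    have hc : ContinuousAt (fun z => (oneChart E H).symm (u s) * (oneChart E H).symm z) e :=
      (mdifferentiable_mul_left_const (E := E) _ _).continuousAt.comp
        (contMDiffAt_oneChart_symm oneChart_one_mem_target).continuousAt
    have hm : (oneChart E H).source ∈ 𝓝 ((oneChart E H).symm (u s) * (oneChart E H).symm e) := by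
      simp only [e, oneChart_symm_one, mul_one]
      exact oneChart_source_mem_nhds ((oneChart E H).map_target hu)
    filter_upwards [hc.eventually_mem hm,
      (isOpen_extChartAt_target (I := 𝓘(ℝ, E)) (1 : H)).mem_nhds oneChart_one_mem_target]
      with z hz hz'
    simp only [C, chartMul, PartialEquiv.left_inv _ hz, γ, inv_mul_cancel_left]
    exact (oneChart E H).right_inv hz'
  have hv : fderiv ℝ C (u s) (fderiv ℝ (chartMul H (u s)) e v) = v :=
    DFunLike.congr_fun (hCB.unique ((hasFDerivAt_id e).congr_of_eventuallyEq hid)) v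
  have h1 := hC.hasFDerivAt.comp_hasDerivAt s hd
  exact HasDerivAt.unique (F := E) (hasDerivAt_oneChart hγ) (h1.congr_deriv hv)

/-- `M` is smooth on `I × V`, and `x ↦ M (x, y)` has left logarithmic derivative `ξ (x, y)`
there. -/
def IsLogSolutionOn (ξ : ℝ × ℝ → E) (M : ℝ × ℝ → H) (I V : Set ℝ) : Prop :=
  ContMDiffOn 𝓘(ℝ, ℝ × ℝ) 𝓘(ℝ, E) ∞ M (I ×ˢ V) ∧
    ∀ x ∈ I, ∀ y ∈ V, leftLogDeriv (E := E) (fun x' => M (x', y)) x = ξ (x, y)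

lemma IsLogSolutionOn.mono {ξ : ℝ × ℝ → E} {M : ℝ × ℝ → H} {I V I' V' : Set ℝ}
    (h : IsLogSolutionOn ξ M I V) (hI : I' ⊆ I) (hV : V' ⊆ V) : IsLogSolutionOn ξ M I' V' :=
  ⟨h.1.mono (prod_mono hI hV), fun x hx y hy => h.2 x (hI hx) y (hV hy)⟩

lemma IsLogSolutionOn.mdifferentiableAt {ξ : ℝ × ℝ → E} {M : ℝ × ℝ → H} {I V : Set ℝ}
    (h : IsLogSolutionOn ξ M I V) (hI : IsOpen I) (hV : IsOpen V) {x y : ℝ} (hx : x ∈ I)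
    (hy : y ∈ V) : MDifferentiableAt 𝓘(ℝ, ℝ) 𝓘(ℝ, E) (fun x' => M (x', y)) x := by
  have h1 : MDifferentiableAt 𝓘(ℝ, ℝ × ℝ) 𝓘(ℝ, E) M (x, y) :=
    (h.1.contMDiffAt ((hI.prod hV).mem_nhds ⟨hx, hy⟩)).mdifferentiableAt (by simp)
  have h2 : MDifferentiableAt 𝓘(ℝ, ℝ) 𝓘(ℝ, ℝ × ℝ) (fun x' : ℝ => (x', y)) x :=
    (differentiableAt_id.prodMk (differentiableAt_const y)).mdifferentiableAt
  exact h1.comp x h2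

/-- Logarithmic differential equations have smooth local solutions. -/
lemma exists_isLogSolutionOn_ball [FiniteDimensional ℝ E] {ξ : ℝ × ℝ → E} (hξ : ContDiff ℝ ∞ ξ)
    (x₀ y₀ : ℝ) : ∃ M : ℝ × ℝ → H, ∃ δ > 0, IsLogSolutionOn ξ M (ball x₀ δ) (ball y₀ δ) := by
  have : CompleteSpace E := FiniteDimensional.complete ℝ E
  let e : E := oneChart E H 1
  -- The left invariant field with value `ξ` at `1`, with the independent variable and the parameter
  -- added to the state so that the system becomes autonomous.
  let vec : E × (ℝ × ℝ) → E := fun w => fderiv ℝ (chartMul H w.1) e (ξ w.2)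
  have htarget : IsOpen (oneChart E H).target := isOpen_extChartAt_target (I := 𝓘(ℝ, E)) (1 : H)
  have hU : (Prod.fst ⁻¹' (oneChart E H).target : Set (E × (ℝ × ℝ))) ∈ 𝓝 (e, (x₀, y₀)) :=
    (htarget.preimage continuous_fst).mem_nhds oneChart_one_mem_target
  have hvec : ∀ w ∈ (Prod.fst ⁻¹' (oneChart E H).target : Set (E × (ℝ × ℝ))),
      ContDiffAt ℝ ∞ vec w := by
    intro w hw
    refine ContDiffAt.clm_apply (ContDiffAt.fderiv (n := ∞) (f := fun w : E × (ℝ × ℝ) =>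
      chartMul H w.1) ?_ contDiffAt_const (by simp)) (hξ.contDiffAt.comp w contDiffAt_snd)
    exact ContDiffAt.comp (w, e) (g := Function.uncurry (chartMul H))
      (f := fun q : (E × (ℝ × ℝ)) × E => (q.1.1, q.2))
      (contDiffAt_chartMul hw) (by fun_prop)
  -- `vec` is controlled only over the chart target, while the flow theorem asks for a globally
  -- smooth field; a cutoff supplies one with the same germ.
  obtain ⟨g, hg, hgv⟩ := exists_contDiff_eventuallyEq hU hvec
  obtain ⟨φ, ε, hε, hφ, hflow⟩ := exists_smooth_localFlow (fun w => (g w, ((1 : ℝ), (0 : ℝ))))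
    (hg.prodMk contDiff_const) (e, (x₀, y₀))
  let j : ℝ × ℝ → (E × (ℝ × ℝ)) × ℝ := fun q => ((e, (x₀, q.2)), q.1 - x₀)
  have hj : ContDiff ℝ ∞ j := by fun_prop
  have hjmem : ∀ q ∈ ball x₀ ε ×ˢ ball y₀ ε, j q ∈ ball (e, (x₀, y₀)) ε ×ˢ ball (0 : ℝ) ε := by
    intro q hq
    refine ⟨?_, by simpa [dist_eq_norm] using hq.1⟩
    simpa [j, Prod.dist_eq, hε] using hq.2
  have hw : ContDiffOn ℝ ∞ (fun q => φ (j q)) (ball x₀ ε ×ˢ ball y₀ ε) :=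
    hφ.comp hj.contDiffOn hjmem
  have hj0 : φ (j (x₀, y₀)) = (e, (x₀, y₀)) := by
    simp only [j, sub_self]
    exact (hflow _ (mem_ball_self hε)).1
  have hcont : ContinuousAt (fun q => φ (j q)) (x₀, y₀) :=
    hw.continuousOn.continuousAt
      ((isOpen_ball.prod isOpen_ball).mem_nhds ⟨mem_ball_self hε, mem_ball_self hε⟩)
  have hev : ∀ᶠ q in 𝓝 (x₀, y₀), q ∈ ball x₀ ε ×ˢ ball y₀ ε ∧
      ((φ (j q)).1 ∈ (oneChart E H).target ∧ g (φ (j q)) = vec (φ (j q))) := by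
    have hbox : ∀ᶠ q in 𝓝 (x₀, y₀), q ∈ ball x₀ ε ×ˢ ball y₀ ε :=
      (isOpen_ball.prod isOpen_ball).mem_nhds ⟨mem_ball_self hε, mem_ball_self hε⟩
    refine hbox.and ?_
    have h := hcont.eventually (p := fun w => w.1 ∈ (oneChart E H).target ∧ g w = vec w)
    exact h (by simp only [hj0]; exact Filter.Eventually.and hU hgv)
  obtain ⟨δ, hδ, hball⟩ := Metric.eventually_nhds_iff_ball.1 hev
  rw [← ball_prod_same] at hball
  -- The state coordinates in `ℝ × ℝ` move with velocity `(1, 0)` from `(x₀, y)`, so after time `x -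
  -- x₀` they are `(x, y)`.
  have hpar : ∀ q ∈ ball x₀ ε ×ˢ ball y₀ ε, (φ (j q)).2 = q := by
    rintro ⟨x, y⟩ hq
    have hm := hjmem _ hq
    have hf := hflow (e, (x₀, y)) hm.1
    have hder : ∀ t ∈ ball (0 : ℝ) ε, HasDerivAt
        (fun t => (φ ((e, (x₀, y)), t)).2 - (t, (0 : ℝ))) (0 : ℝ × ℝ) t := by
      intro t ht
      have h1 : HasDerivAt (fun t => (φ ((e, (x₀, y)), t)).2) ((1 : ℝ), (0 : ℝ)) t :=
        (ContinuousLinearMap.snd ℝ E (ℝ × ℝ)).hasFDerivAt.comp_hasDerivAt t (hf.2 t ht)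
      have h2 : HasDerivAt (fun t : ℝ => (t, (0 : ℝ))) ((1 : ℝ), (0 : ℝ)) t :=
        (hasDerivAt_id t).prodMk (hasDerivAt_const t (0 : ℝ))
      exact (h1.sub h2).congr_deriv (sub_self _)
    have hconst := (convex_ball (0 : ℝ) ε).is_const_of_fderivWithin_eq_zero (𝕜 := ℝ)
      (fun t ht => (hder t ht).differentiableAt.differentiableWithinAt)
      (fun t ht => by
        rw [fderivWithin_of_isOpen isOpen_ball ht, (hder t ht).hasFDerivAt.fderiv]; ext <;> simp)
      hm.2 (mem_ball_self hε)
    simp only [hf.1] at hconst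
    have := eq_add_of_sub_eq hconst
    simpa [j] using this
  refine ⟨fun q => (oneChart E H).symm (φ (j q)).1, δ, hδ, fun q hq => ?_, fun x hx y hy => ?_⟩
  · obtain ⟨h1, h2, h3⟩ := hball q hq
    have h4 : ContDiffAt ℝ ∞ (fun q => (φ (j q)).1) q :=
      contDiffAt_fst.comp q (hw.contDiffAt ((isOpen_ball.prod isOpen_ball).mem_nhds h1))
    exact (ContMDiffAt.comp q (contMDiffAt_oneChart_symm h2) h4.contMDiffAt).contMDiffWithinAt
  · obtain ⟨h1, h2, h3⟩ := hball (x, y) ⟨hx, hy⟩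
    refine leftLogDeriv_oneChart_symm (u := fun x' => (φ (j (x', y))).1) h2 ?_
    have hm := hjmem _ h1
    have h4 : HasDerivAt (fun t => (φ ((e, (x₀, y)), t)).1) (g (φ (j (x, y)))) (x - x₀) :=
      (ContinuousLinearMap.fst ℝ E (ℝ × ℝ)).hasFDerivAt.comp_hasDerivAt _
        ((hflow (e, (x₀, y)) hm.1).2 (x - x₀) hm.2)
    have h5 := HasDerivAt.comp_sub_const x x₀ h4
    refine h5.congr_deriv ?_
    refine h3.trans ?_
    simp only [vec, hpar _ h1, e]

lemma IsLogSolutionOn.congr {ξ : ℝ × ℝ → E} {M N : ℝ × ℝ → H} {I V : Set ℝ}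
    (h : IsLogSolutionOn ξ M I V) (hI : IsOpen I) (hMN : EqOn N M (I ×ˢ V)) :
    IsLogSolutionOn ξ N I V := by
  refine ⟨h.1.congr hMN, fun x hx y hy => (leftLogDeriv_congr ?_).trans (h.2 x hx y hy)⟩
  filter_upwards [hI.mem_nhds hx] with x' hx' using hMN ⟨hx', hy⟩

lemma IsLogSolutionOn.union {ξ : ℝ × ℝ → E} {M : ℝ × ℝ → H} {I J V : Set ℝ}
    (h : IsLogSolutionOn ξ M I V) (h' : IsLogSolutionOn ξ M J V) (hI : IsOpen I) (hJ : IsOpen J)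
    (hV : IsOpen V) : IsLogSolutionOn ξ M (I ∪ J) V := by
  refine ⟨?_, fun x hx y hy => hx.elim (fun hx => h.2 x hx y hy) (fun hx => h'.2 x hx y hy)⟩
  rw [union_prod]
  exact h.1.union_of_isOpen h'.1 (hI.prod hV) (hJ.prod hV)

/-- Left translation by a function of the parameter preserves solutions. -/
lemma IsLogSolutionOn.mul_left {ξ : ℝ × ℝ → E} {M : ℝ × ℝ → H} {I V : Set ℝ}
    (h : IsLogSolutionOn ξ M I V) (hI : IsOpen I) (hV : IsOpen V) {a : ℝ → H}
    (ha : ContMDiffOn 𝓘(ℝ, ℝ) 𝓘(ℝ, E) ∞ a V) :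
    IsLogSolutionOn ξ (fun q => a q.2 * M q) I V := by
  refine ⟨?_, fun x hx y hy => ?_⟩
  · refine ContMDiffOn.mul (ha.comp contDiff_snd.contMDiff.contMDiffOn fun q hq => hq.2) h.1
  · exact (leftLogDeriv_mul_left (a y) (h.mdifferentiableAt hI hV hx hy)).trans (h.2 x hx y hy)

lemma IsLogSolutionOn.contMDiffOn_slice {ξ : ℝ × ℝ → E} {M : ℝ × ℝ → H} {I V : Set ℝ}
    (h : IsLogSolutionOn ξ M I V) {x : ℝ} (hx : x ∈ I) :
    ContMDiffOn 𝓘(ℝ, ℝ) 𝓘(ℝ, E) ∞ (fun y => M (x, y)) V :=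
  h.1.comp (contDiff_const.prodMk contDiff_id).contMDiff.contMDiffOn fun _ hy => ⟨hx, hy⟩

lemma IsLogSolutionOn.eq_mul {ξ : ℝ × ℝ → E} {M N : ℝ × ℝ → H} {I V J W : Set ℝ}
    (h : IsLogSolutionOn ξ M I V) (h' : IsLogSolutionOn ξ N J W) (hI : IsOpen I) (hV : IsOpen V)
    (hJ : IsOpen J) (hW : IsOpen W) (hIJ : IsPreconnected (I ∩ J)) {x₀ x y : ℝ}
    (hx₀ : x₀ ∈ I ∩ J) (hx : x ∈ I ∩ J) (hy : y ∈ V ∩ W) :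
    M (x, y) = M (x₀, y) * (N (x₀, y))⁻¹ * N (x, y) :=
  eq_mul_of_leftLogDeriv_eq (E := E) (γ := fun x => M (x, y)) (γ' := fun x => N (x, y))
    (hI.inter hJ) hIJ (fun _ hs => h.mdifferentiableAt hI hV hs.1 hy.1)
    (fun _ hs => h'.mdifferentiableAt hJ hW hs.2 hy.2)
    (fun _ hs => (h.2 _ hs.1 _ hy.1).trans (h'.2 _ hs.2 _ hy.2).symm) hx₀ hx

/-- Solutions on overlapping intervals can be glued. -/
lemma IsLogSolutionOn.exists_glue {ξ : ℝ × ℝ → E} {M N : ℝ × ℝ → H} {I J V : Set ℝ}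
    (h : IsLogSolutionOn ξ M I V) (h' : IsLogSolutionOn ξ N J V) (hI : IsOpen I) (hJ : IsOpen J)
    (hV : IsOpen V) (hIJ : IsPreconnected (I ∩ J)) (hne : (I ∩ J).Nonempty) :
    ∃ L : ℝ × ℝ → H, IsLogSolutionOn ξ L (I ∪ J) V := by
  classical
  obtain ⟨p, hp⟩ := hne
  -- `N` is translated, separately for each parameter, so as to agree with `M` at `p`; uniqueness
  -- then makes them agree on the whole overlap.
  let N' : ℝ × ℝ → H := fun q => (M (p, q.2) * (N (p, q.2))⁻¹) * N q
  have hN' : IsLogSolutionOn ξ N' J V := h'.mul_left hJ hV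
    (a := fun y => M (p, y) * (N (p, y))⁻¹)
    ((h.contMDiffOn_slice hp.1).mul (h'.contMDiffOn_slice hp.2).inv)
  refine ⟨fun q => if q.1 ∈ I then M q else N' q,
    (h.congr hI fun q hq => if_pos hq.1).union (hN'.congr hJ fun q hq => ?_) hI hJ hV⟩
  by_cases hq' : q.1 ∈ I
  · exact (if_pos hq').trans (h.eq_mul h' hI hV hJ hV hIJ hp ⟨hq', hq.1⟩ ⟨hq.2, hq.2⟩)
  · exact if_neg hq'

variable [FiniteDimensional ℝ E]

/-- Over every bounded interval there is a solution that is smooth in a parameter near a given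
value. -/
lemma exists_isLogSolutionOn_Ioo {ξ : ℝ × ℝ → E} (hξ : ContDiff ℝ ∞ ξ) (y₀ R : ℝ) :
    ∃ M : ℝ × ℝ → H, ∃ δ > 0, IsLogSolutionOn ξ M (Ioo (-R) R) (ball y₀ δ) := by
  let S : Set ℝ := {a | 0 < a ∧ ∃ M : ℝ × ℝ → H, ∃ δ > 0,
    IsLogSolutionOn ξ M (Ioo (-a) a) (ball y₀ δ)}
  have hne : S.Nonempty := by
    obtain ⟨M, δ, hδ, hM⟩ := exists_isLogSolutionOn_ball (H := H) hξ 0 y₀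
    refine ⟨δ, hδ, M, δ, hδ, ?_⟩
    rwa [Real.ball_eq_Ioo, zero_sub, zero_add] at hM
  suffices hunb : ¬ BddAbove S by
    obtain ⟨a, ha, hRa⟩ := not_bddAbove_iff.1 hunb R
    obtain ⟨-, M, δ, hδ, hM⟩ := ha
    exact ⟨M, δ, hδ, hM.mono (Ioo_subset_Ioo (neg_le_neg hRa.le) hRa.le) subset_rfl⟩
  intro hbdd
  set s := sSup S
  have hspos : 0 < s := by
    obtain ⟨a, ha⟩ := hne
    exact ha.1.trans_le (le_csSup hbdd ha)
  obtain ⟨M₁, δ₁, hδ₁, hM₁⟩ := exists_isLogSolutionOn_ball (H := H) hξ s y₀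
  obtain ⟨M₂, δ₂, hδ₂, hM₂⟩ := exists_isLogSolutionOn_ball (H := H) hξ (-s) y₀
  -- If the half-lengths were bounded with supremum `s`, local solutions around `s` and `-s` would
  -- overlap a solution on `(-a, a)` with `a > s - η`. Gluing on both ends reaches `s + η`, a
  -- contradiction. The parameter interval shrinks only finitely often.
  obtain ⟨η, hη, hη₁, hη₂, hηs⟩ : ∃ η > 0, η ≤ δ₁ ∧ η ≤ δ₂ ∧ η < s :=
    ⟨min (min δ₁ δ₂) (s / 2), by positivity, (min_le_left _ _).trans (min_le_left _ _),
      (min_le_left _ _).trans (min_le_right _ _), (min_le_right _ _).trans_lt (half_lt_self hspos)⟩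
  obtain ⟨a, haS, ha⟩ := exists_lt_of_lt_csSup hne (show s - η < s by linarith)
  have has : a ≤ s := le_csSup hbdd haS
  obtain ⟨ha0, M, δ, hδ, hM⟩ := haS
  let ρ := min δ η
  have hρ : 0 < ρ := lt_min hδ hη
  have hV : IsOpen (ball y₀ ρ) := isOpen_ball
  rw [Real.ball_eq_Ioo] at hM₁ hM₂
  have k₁ : IsLogSolutionOn ξ M₁ (Ioo (s - η) (s + η)) (ball y₀ ρ) :=
    hM₁.mono (Ioo_subset_Ioo (by linarith) (by linarith))
      (ball_subset_ball ((min_le_right _ _).trans hη₁))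
  have k₂ : IsLogSolutionOn ξ M₂ (Ioo (-s - η) (-s + η)) (ball y₀ ρ) :=
    hM₂.mono (Ioo_subset_Ioo (by linarith) (by linarith))
      (ball_subset_ball ((min_le_right _ _).trans hη₂))
  have k : IsLogSolutionOn ξ M (Ioo (-a) a) (ball y₀ ρ) :=
    hM.mono subset_rfl (ball_subset_ball (min_le_left _ _))
  obtain ⟨L, hL⟩ := k.exists_glue k₁ isOpen_Ioo isOpen_Ioo hV
    (by rw [Ioo_inter_Ioo]; exact isPreconnected_Ioo)
    ⟨(max (s - η) (-a) + a) / 2, by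
      have h1 := le_max_left (s - η) (-a)
      have h2 := le_max_right (s - η) (-a)
      have h3 : max (s - η) (-a) < a := max_lt ha (by linarith)
      refine ⟨⟨?_, ?_⟩, ?_, ?_⟩ <;> linarith⟩
  rw [Ioo_union_Ioo' (by linarith) (by linarith), min_eq_left (by linarith),
    max_eq_right (by linarith)] at hL
  obtain ⟨L', hL'⟩ := k₂.exists_glue hL isOpen_Ioo isOpen_Ioo hV
    (by rw [Ioo_inter_Ioo]; exact isPreconnected_Ioo)
    ⟨(-a + (-s + η)) / 2, by
      refine ⟨⟨?_, ?_⟩, ?_, ?_⟩ <;> linarith⟩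
  rw [Ioo_union_Ioo' (by linarith) (by linarith), min_eq_left (by linarith),
    max_eq_right (by linarith)] at hL'
  have hmem : s + η ∈ S := ⟨by linarith, L', ρ, hρ, by
    rwa [neg_add']⟩
  have := le_csSup hbdd hmem
  linarith

/-- Logarithmic differential equations depending smoothly on a parameter have globally defined
smooth solutions. -/
theorem exists_isLogSolutionOn_univ {ξ : ℝ × ℝ → E} (hξ : ContDiff ℝ ∞ ξ) :
    ∃ L : ℝ × ℝ → H, IsLogSolutionOn ξ L univ univ ∧ ∀ y, L (0, y) = 1 := by
  choose M δ hδ hM using fun y R => exists_isLogSolutionOn_Ioo (H := H) hξ y R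
  let N : ℝ → ℝ → ℝ × ℝ → H := fun y₀ R q => (M y₀ R (0, q.2))⁻¹ * M y₀ R q
  have hN : ∀ y₀ R, 0 < R → IsLogSolutionOn ξ (N y₀ R) (Ioo (-R) R) (ball y₀ (δ y₀ R)) := by
    intro y₀ R hR
    exact (hM y₀ R).mul_left isOpen_Ioo isOpen_ball (a := fun y => (M y₀ R (0, y))⁻¹)
      ((hM y₀ R).contMDiffOn_slice ⟨by linarith, hR⟩).inv
  have hN0 : ∀ y₀ R y, N y₀ R (0, y) = 1 := fun y₀ R y => inv_mul_cancel _
  -- The normalised solutions agree wherever their domains meet. Centring at `q.2` with half-length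
  -- `|q.1| + 1` merely selects one whose domain contains `q`.
  let L : ℝ × ℝ → H := fun q => N q.2 (|q.1| + 1) q
  have hL : ∀ y₀ R, 0 < R → IsLogSolutionOn ξ L (Ioo (-R) R) (ball y₀ (δ y₀ R)) := by
    intro y₀ R hR
    refine (hN y₀ R hR).congr isOpen_Ioo ?_
    rintro ⟨x, y⟩ ⟨hx, hy⟩
    have hx1 : 0 < |x| + 1 := by positivity
    have h := (hN y (|x| + 1) hx1).eq_mul (hN y₀ R hR) isOpen_Ioo isOpen_ball isOpen_Ioo
      isOpen_ball (by rw [Ioo_inter_Ioo]; exact isPreconnected_Ioo) (x₀ := 0) (x := x) (y := y)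
      ⟨⟨by linarith, hx1⟩, by linarith, hR⟩ ⟨abs_lt.1 (lt_add_one _), hx⟩
      ⟨mem_ball_self (hδ _ _), hy⟩
    rwa [hN0, hN0, inv_one, mul_one, one_mul] at h
  refine ⟨L, ⟨?_, fun x _ y _ => ?_⟩, fun y => hN0 _ _ _⟩
  · rintro ⟨x, y⟩ -
    have hx1 : 0 < |x| + 1 := by positivity
    exact ((hL y (|x| + 1) hx1).1.contMDiffAt ((isOpen_Ioo.prod isOpen_ball).mem_nhds
      ⟨abs_lt.1 (lt_add_one _), mem_ball_self (hδ _ _)⟩)).contMDiffWithinAt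
  · have hx1 : 0 < |x| + 1 := by positivity
    exact (hL y (|x| + 1) hx1).2 x (abs_lt.1 (lt_add_one _)) y (mem_ball_self (hδ _ _))

end Existence

/-! ### Crossed transports and their generators -/

section Transport

variable {EG : Type*} [NormedAddCommGroup EG] [NormedSpace ℝ EG]
  {G : Type*} [TopologicalSpace G] [ChartedSpace EG G] [Group G] [LieGroup 𝓘(ℝ, EG) ∞ G]
  {EH : Type*} [NormedAddCommGroup EH] [NormedSpace ℝ EH]
  {H : Type*} [TopologicalSpace H] [ChartedSpace EH H] [Group H] [LieGroup 𝓘(ℝ, EH) ∞ H]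

/-- A smooth family of multiplicative two-point functions `f(x', x; y)`. -/
structure IsTransport (f : ℝ → ℝ → ℝ → G) : Prop where
  contMDiff : ContMDiff 𝓘(ℝ, ℝ × ℝ × ℝ) 𝓘(ℝ, EG) ∞ (fun p : ℝ × ℝ × ℝ => f p.1 p.2.1 p.2.2)
  comp : ∀ x'' x' x y : ℝ, f x'' x y = f x'' x' y * f x' x y

/-- A smooth family of two-point functions `Ψ(x', x; y)` that are crossed multiplicative with
respect to `f`. -/
structure IsCrossedTransport (X : LieCrossedModule EG G EH H) (f : ℝ → ℝ → ℝ → G)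
    (Ψ : ℝ → ℝ → ℝ → H) : Prop where
  contMDiff : ContMDiff 𝓘(ℝ, ℝ × ℝ × ℝ) 𝓘(ℝ, EH) ∞ (fun p : ℝ × ℝ × ℝ => Ψ p.1 p.2.1 p.2.2)
  comp : ∀ x'' x' x y : ℝ, Ψ x'' x y = Ψ x' x y * X.m (f x' x y)⁻¹ (Ψ x'' x' y)

variable {X : LieCrossedModule EG G EH H} {f : ℝ → ℝ → ℝ → G} {Ψ : ℝ → ℝ → ℝ → H}

lemma IsTransport.self (hf : IsTransport (EG := EG) f) (x y : ℝ) : f x x y = 1 :=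
  left_eq_mul.1 (hf.comp x x x y)

lemma IsCrossedTransport.self (hf : IsTransport (EG := EG) f) (hΨ : IsCrossedTransport X f Ψ)
    (x y : ℝ) : Ψ x x y = 1 := by
  have h := hΨ.comp x x x y
  rw [hf.self, inv_one, map_one, MulAut.one_apply] at h
  exact left_eq_mul.1 h

lemma IsCrossedTransport.mdifferentiable (hΨ : IsCrossedTransport X f Ψ) (x y : ℝ) :
    MDifferentiable 𝓘(ℝ, ℝ) 𝓘(ℝ, EH) (fun x' => Ψ x' x y) := by
  have h : ContDiff ℝ ∞ (fun x' : ℝ => (x', x, y)) := by fun_prop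
  exact (hΨ.contMDiff.comp h.contMDiff).mdifferentiable (by simp)

/-- The infinitesimal generator of `Ψ`. -/
def generator (EH : Type*) [NormedAddCommGroup EH] [NormedSpace ℝ EH]
    {H : Type*} [TopologicalSpace H] [ChartedSpace EH H] [Group H]
    (Ψ : ℝ → ℝ → ℝ → H) (x y : ℝ) : GroupLieAlgebra 𝓘(ℝ, EH) H :=
  leftLogDeriv (E := EH) (fun x' => Ψ x' x y) x

/-- A crossed transport solves the differential equation given by its generator. -/
lemma IsCrossedTransport.solvesLeftLog (hf : IsTransport (EG := EG) f)
    (hΨ : IsCrossedTransport X f Ψ) (x₀ y : ℝ) :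
    SolvesLeftLog (E := EH) (fun x => X.mDot (f x x₀ y)⁻¹ (generator EH Ψ x y)) x₀
      (fun x => Ψ x x₀ y) := by
  refine ⟨hΨ.mdifferentiable x₀ y, fun x => ?_, hΨ.self hf x₀ y⟩
  -- The composition law through the intermediate point `x` leaves all dependence on `x'` in `Ψ x' x
  -- y`, whose logarithmic derivative at `x' = x` is the generator.
  have h1 : (fun x' => Ψ x' x₀ y) = fun x' => Ψ x x₀ y * X.m (f x x₀ y)⁻¹ (Ψ x' x y) :=
    funext fun x' => hΨ.comp x' x x₀ y
  rw [h1]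
  refine (leftLogDeriv_mul_left _
    ((X.mdifferentiable_m _ _).comp x (hΨ.mdifferentiable x y x))).trans ?_
  exact (X.mDot_leftLogDeriv _ (hΨ.mdifferentiable x y x)).symm

/-- Since `Ψ x x y = 1`, the generator is an ordinary partial derivative on the diagonal in the
chart at `1`, with no translation involved. -/
lemma IsCrossedTransport.contDiff_generator (hf : IsTransport (EG := EG) f)
    (hΨ : IsCrossedTransport X f Ψ) :
    ContDiff ℝ ∞ (F := EH) (fun p : ℝ × ℝ => generator EH Ψ p.1 p.2) := by
  let F : ℝ × ℝ → ℝ → EH := fun p x' => oneChart EH H (Ψ x' p.1 p.2)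
  have hF : (fun p : ℝ × ℝ => generator EH Ψ p.1 p.2) =
      fun p => fderiv ℝ (F p) p.1 (1 : ℝ) := by
    funext p
    have h := hasDerivAt_oneChart (hΨ.mdifferentiable p.1 p.2 p.1)
    simp only [hΨ.self hf, inv_one, one_mul] at h
    exact (fderiv_apply_one_eq_deriv.trans h.deriv).symm
  rw [hF, contDiff_iff_contDiffAt]
  intro p
  refine ContDiffAt.clm_apply (ContDiffAt.fderiv (n := ∞) ?_ contDiffAt_fst (by simp))
    contDiffAt_const
  have h1 : ContDiff ℝ ∞ (fun q : (ℝ × ℝ) × ℝ => (q.2, q.1.1, q.1.2)) := by fun_prop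
  refine contDiffAt_oneChart_comp (hΨ.contMDiff.comp h1.contMDiff).contMDiffAt ?_
  simp only [hΨ.self hf, oneChart_one_mem_source]

/-- Every smooth function is the generator of a crossed transport. -/
lemma exists_isCrossedTransport [FiniteDimensional ℝ EH] (X : LieCrossedModule EG G EH H)
    (hf : IsTransport (EG := EG) f) {η : ℝ × ℝ → EH} (hη : ContDiff ℝ ∞ η) :
    ∃ Ψ : ℝ → ℝ → ℝ → H, IsCrossedTransport X f Ψ ∧
      ∀ x y, generator EH Ψ x y = η (x, y) := by
  have hf0 : ContMDiff 𝓘(ℝ, ℝ × ℝ) 𝓘(ℝ, EG) ∞ (fun p : ℝ × ℝ => (f p.1 0 p.2)⁻¹) := by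
    have h : ContDiff ℝ ∞ (fun p : ℝ × ℝ => (p.1, (0 : ℝ), p.2)) := by fun_prop
    exact (hf.contMDiff.comp h.contMDiff).inv
  have hfinv : ∀ x x' y, (f x x' y)⁻¹ = f x' x y := fun x x' y =>
    inv_eq_of_mul_eq_one_left (by rw [← hf.comp, hf.self])
  obtain ⟨L, ⟨hLs, hL⟩, -⟩ := exists_isLogSolutionOn_univ (H := H) (X.contDiff_mDot hf0 hη)
  rw [univ_prod_univ, contMDiffOn_univ] at hLs
  have hLd : ∀ y, MDifferentiable 𝓘(ℝ, ℝ) 𝓘(ℝ, EH) (fun x => L (x, y)) := fun y => by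
    have h : ContDiff ℝ ∞ (fun x : ℝ => (x, y)) := by fun_prop
    exact (hLs.comp h.contMDiff).mdifferentiable (by simp)
  have hLd' : ∀ x y, MDifferentiable 𝓘(ℝ, ℝ) 𝓘(ℝ, EH) (fun x' => (L (x, y))⁻¹ * L (x', y)) :=
    fun x y s => (mdifferentiable_mul_left_const (E := EH) _ _).comp s (hLd y s)
  -- The base point `0` is arbitrary. Composition telescopes because `(f x' x y)⁻¹ * f x' 0 y = f x
  -- 0 y`, and the twist `f x 0 y` cancels the inverse twist in the equation for `L`.
  refine ⟨fun x' x y => X.m (f x 0 y) ((L (x, y))⁻¹ * L (x', y)), ⟨?_, fun x'' x' x y => ?_⟩,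
    fun x y => ?_⟩
  · have h1 : ContDiff ℝ ∞ (fun p : ℝ × ℝ × ℝ => (p.2.1, (0 : ℝ), p.2.2)) := by fun_prop
    have h2 : ContDiff ℝ ∞ (fun p : ℝ × ℝ × ℝ => (p.2.1, p.2.2)) := by fun_prop
    have h3 : ContDiff ℝ ∞ (fun p : ℝ × ℝ × ℝ => (p.1, p.2.2)) := by fun_prop
    exact X.contMDiff_action (hf.contMDiff.comp h1.contMDiff)
      ((hLs.comp h2.contMDiff).inv.mul (hLs.comp h3.contMDiff))
  · rw [hfinv, ← MulAut.mul_apply, ← map_mul, ← hf.comp, ← map_mul]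
    group
  · have h1 := X.mDot_leftLogDeriv (f x 0 y) (hLd' x y x)
    have h2 := leftLogDeriv_mul_left (E := EH) (L (x, y))⁻¹ (hLd y x)
    have h3 := hL x trivial y trivial
    refine h1.symm.trans ((congrArg (X.mDot (f x 0 y)) (h2.trans h3)).trans ?_)
    refine (X.mDot_mul _ _ _).symm.trans ?_
    rw [mul_inv_cancel]
    exact X.mDot_one _

end Transport

/-! ### The correspondence between integral and differential data -/

section Correspondence

variable {EG : Type*} [NormedAddCommGroup EG] [NormedSpace ℝ EG]
  {G : Type*} [TopologicalSpace G] [ChartedSpace EG G] [Group G] [LieGroup 𝓘(ℝ, EG) ∞ G]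
  {EH : Type*} [NormedAddCommGroup EH] [NormedSpace ℝ EH]
  {H : Type*} [TopologicalSpace H] [ChartedSpace EH H] [Group H] [LieGroup 𝓘(ℝ, EH) ∞ H]
  {X : LieCrossedModule EG G EH H} {c : Cocycle X}

attribute [ext] IntegralGauge DifferentialGauge

/-- The constant 1-form `a dx + b dy`. -/
def oneForm {F : Type*} [NormedAddCommGroup F] [NormedSpace ℝ F] (a b : F) : ℝ × ℝ →L[ℝ] F :=
  (ContinuousLinearMap.fst ℝ ℝ ℝ).smulRight a + (ContinuousLinearMap.snd ℝ ℝ ℝ).smulRight b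

@[simp]
lemma oneForm_dx {F : Type*} [NormedAddCommGroup F] [NormedSpace ℝ F] (a b : F) :
    oneForm a b (1, 0) = a := by simp [oneForm]

@[simp]
lemma oneForm_dy {F : Type*} [NormedAddCommGroup F] [NormedSpace ℝ F] (a b : F) :
    oneForm a b (0, 1) = b := by simp [oneForm]

lemma contDiff_oneForm {F P : Type*} [NormedAddCommGroup F] [NormedSpace ℝ F]
    [NormedAddCommGroup P] [NormedSpace ℝ P] {a b : P → F} (ha : ContDiff ℝ ∞ a)
    (hb : ContDiff ℝ ∞ b) : ContDiff ℝ ∞ (fun p => oneForm (a p) (b p)) :=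
  (contDiff_const.smulRight ha).add (contDiff_const.smulRight hb)

variable (c) in
lemma Cocycle.isTransport_f : IsTransport (EG := EG) c.f := ⟨c.contMDiff_f, c.f_comp⟩

variable (c) in
/-- The transport `g` of a cocycle, with the parameter as last argument. -/
def Cocycle.gSwap (y' y x : ℝ) : G := c.g x y' y

variable (c) in
lemma Cocycle.isTransport_gSwap : IsTransport (EG := EG) c.gSwap := by
  refine ⟨?_, fun y'' y' y x => c.g_comp x y'' y' y⟩
  have h : ContDiff ℝ ∞ (fun p : ℝ × ℝ × ℝ => (p.2.2, p.1, p.2.1)) := by fun_prop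
  exact c.contMDiff_g.comp h.contMDiff

namespace IntegralGauge

variable (T : IntegralGauge c)

/-- The component `Φ`, with the parameter as last argument. -/
def ΦSwap (y' y x : ℝ) : H := T.Φ x y' y

lemma isCrossedTransport_Ψ : IsCrossedTransport X c.f T.Ψ := ⟨T.contMDiff_Ψ, T.Ψ_comp⟩

lemma isCrossedTransport_ΦSwap : IsCrossedTransport X c.gSwap T.ΦSwap := by
  refine ⟨?_, fun y'' y' y x => T.Φ_comp x y'' y' y⟩
  have h : ContDiff ℝ ∞ (fun p : ℝ × ℝ × ℝ => (p.2.2, p.1, p.2.1)) := by fun_prop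
  exact T.contMDiff_Φ.comp h.contMDiff

/-- The differential gauge transformation of an integral one. -/
def toDifferential : DifferentialGauge EG G EH H where
  ϰ p := T.κ p.1 p.2
  Γ p := oneForm (F := EH) (-X.mDot (T.κ p.1 p.2) (generator EH T.Ψ p.1 p.2))
    (-X.mDot (T.κ p.1 p.2) (generator EH T.ΦSwap p.2 p.1))
  contMDiff_ϰ := T.contMDiff_κ
  contDiff_Γ := by
    have h1 := X.contDiff_mDot T.contMDiff_κ (T.isCrossedTransport_Ψ.contDiff_generator
      c.isTransport_f)
    have h2 : ContDiff ℝ ∞ (F := EH) (fun p : ℝ × ℝ => generator EH T.ΦSwap p.2 p.1) :=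
      (T.isCrossedTransport_ΦSwap.contDiff_generator c.isTransport_gSwap).comp
        (contDiff_snd.prodMk contDiff_fst)
    have h3 := X.contDiff_mDot T.contMDiff_κ h2
    exact contDiff_oneForm (ContDiff.neg (F := EH) h1) (ContDiff.neg (F := EH) h3)

lemma toDifferential_Γx (x y : ℝ) :
    T.toDifferential.Γx x y = -X.mDot (T.κ x y) (generator EH T.Ψ x y) :=
  oneForm_dx (F := EH) _ _

lemma toDifferential_Γy (x y : ℝ) :
    T.toDifferential.Γy x y = -X.mDot (T.κ x y) (generator EH T.ΦSwap y x) :=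
  oneForm_dy (F := EH) _ _

end IntegralGauge

lemma LieCrossedModule.neg_mDot_neg_mDot (X : LieCrossedModule EG G EH H) (a k : G)
    (v : GroupLieAlgebra 𝓘(ℝ, EH) H) : -X.mDot (a * k⁻¹) (-X.mDot k v) = X.mDot a v := by
  have h : X.mDot (a * k⁻¹) (X.mDot k v) = X.mDot a v := by
    rw [← X.mDot_mul, inv_mul_cancel_right]
  refine (congrArg (fun w : EH => -w) (X.mDot_neg _ _)).trans ((neg_neg (_ : EH)).trans h)

namespace IntegralGauge

variable (T : IntegralGauge c)

/-- The component `Ψ` solves the differential equation given by the differential gauge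
transformation. -/
lemma solvesLeftLog_Ψ (x₀ y : ℝ) : SolvesLeftLog (E := EH)
    (fun x => -X.mDot ((c.f x x₀ y)⁻¹ * (T.toDifferential.ϰ (x, y))⁻¹)
      (T.toDifferential.Γx x y)) x₀ (fun x => T.Ψ x x₀ y) := by
  convert T.isCrossedTransport_Ψ.solvesLeftLog c.isTransport_f x₀ y using 2 with x
  rw [T.toDifferential_Γx]
  exact X.neg_mDot_neg_mDot _ _ _

/-- The component `Φ` solves the differential equation given by the differential gauge
transformation. -/
lemma solvesLeftLog_Φ (x y₀ : ℝ) : SolvesLeftLog (E := EH)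
    (fun y => -X.mDot ((c.g x y y₀)⁻¹ * (T.toDifferential.ϰ (x, y))⁻¹)
      (T.toDifferential.Γy x y)) y₀ (fun y => T.Φ x y y₀) := by
  convert T.isCrossedTransport_ΦSwap.solvesLeftLog c.isTransport_gSwap y₀ x using 2 with y
  · rw [T.toDifferential_Γy]
    exact X.neg_mDot_neg_mDot _ _ _
  · rfl

/-- `Ψ` and `Φ` solve initial value problems whose data involve only the cocycle and the image, so
uniqueness recovers them. -/
lemma toDifferential_injective :
    Function.Injective (toDifferential : IntegralGauge c → DifferentialGauge EG G EH H) := by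
  intro T T' h
  ext x y z
  · exact congrFun (congrArg DifferentialGauge.ϰ h) (x, y)
  · have h1 := T.solvesLeftLog_Ψ y z
    rw [h] at h1
    exact congrFun (h1.unique (T'.solvesLeftLog_Ψ y z)) x
  · have h1 := T.solvesLeftLog_Φ x z
    rw [h] at h1
    exact congrFun (h1.unique (T'.solvesLeftLog_Φ x z)) y

lemma toDifferential_surjective [FiniteDimensional ℝ EH] :
    Function.Surjective (toDifferential : IntegralGauge c → DifferentialGauge EG G EH H) := by
  intro D
  have hx : ContDiff ℝ ∞ (F := EH) (fun p : ℝ × ℝ => D.Γx p.1 p.2) :=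
    ContDiff.clm_apply (F := ℝ × ℝ) (G := EH) D.contDiff_Γ contDiff_const
  have hy : ContDiff ℝ ∞ (F := EH) (fun p : ℝ × ℝ => D.Γy p.1 p.2) :=
    ContDiff.clm_apply (F := ℝ × ℝ) (G := EH) D.contDiff_Γ contDiff_const
  have hswap : ContDiff ℝ ∞ (fun p : ℝ × ℝ => (p.2, p.1)) := contDiff_snd.prodMk contDiff_fst
  -- The prescribed generators are `-ṁ(ϰ⁻¹)(Γ_x)` and `-ṁ(ϰ⁻¹)(Γ_y)`, obtained by solving `Γ =
  -- -ṁ(ϰ)(generator)`. The second has its variables exchanged to match `gSwap`, where `x` is the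
  -- parameter.
  have hx' := ContDiff.neg (F := EH) (X.contDiff_mDot D.contMDiff_ϰ.inv hx)
  have hy' := (ContDiff.neg (F := EH) (X.contDiff_mDot D.contMDiff_ϰ.inv hy)).comp hswap
  obtain ⟨Ψ, hΨ, hΨg⟩ := exists_isCrossedTransport X c.isTransport_f hx'
  obtain ⟨Φ, hΦ, hΦg⟩ := exists_isCrossedTransport X c.isTransport_gSwap hy'
  let T : IntegralGauge c :=
    { κ := fun x y => D.ϰ (x, y)
      Ψ := Ψ
      Φ := fun x y' y => Φ y' y x
      contMDiff_κ := D.contMDiff_ϰ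
      contMDiff_Ψ := hΨ.contMDiff
      contMDiff_Φ := by
        have h : ContDiff ℝ ∞ (fun p : ℝ × ℝ × ℝ => (p.2.1, p.2.2, p.1)) := by fun_prop
        exact hΦ.contMDiff.comp h.contMDiff
      Ψ_comp := hΨ.comp
      Φ_comp := fun x y'' y' y => hΦ.comp y'' y' y x }
  have hcancel : ∀ (k : G) (v w : GroupLieAlgebra 𝓘(ℝ, EH) H), w = -X.mDot k⁻¹ v →
      -X.mDot k w = v := by
    intro k v w hw
    have h := X.neg_mDot_neg_mDot 1 k⁻¹ v
    rwa [one_mul, inv_inv, X.mDot_one, ← hw] at h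
  have hTx : ∀ x y, T.toDifferential.Γx x y = D.Γx x y := fun x y =>
    (T.toDifferential_Γx x y).trans (hcancel _ _ _ (hΨg x y))
  have hTy : ∀ x y, T.toDifferential.Γy x y = D.Γy x y := fun x y =>
    (T.toDifferential_Γy x y).trans (hcancel _ _ _ (hΦg y x))
  refine ⟨T, DifferentialGauge.ext rfl (funext fun p => ?_)⟩
  refine ContinuousLinearMap.ext fun v => ?_
  have hv : v = v.1 • ((1 : ℝ), (0 : ℝ)) + v.2 • ((0 : ℝ), (1 : ℝ)) := by ext <;> simp
  rw [hv, map_add, map_add, map_smul, map_smul, map_smul, map_smul]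
  exact congrArg₂ (fun a b : EH => v.1 • a + v.2 • b) (hTx p.1 p.2) (hTy p.1 p.2)

end IntegralGauge

end Correspondence

end HigherGauge

end

open HigherGauge in
theorem mainTheorem2
    {EG : Type*} [NormedAddCommGroup EG] [NormedSpace ℝ EG] [FiniteDimensional ℝ EG]
    {G : Type*} [TopologicalSpace G] [T2Space G] [ChartedSpace EG G] [Group G]
    [LieGroup 𝓘(ℝ, EG) ∞ G]
    {EH : Type*} [NormedAddCommGroup EH] [NormedSpace ℝ EH] [FiniteDimensional ℝ EH]
    {H : Type*} [TopologicalSpace H] [T2Space H] [ChartedSpace EH H] [Group H]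
    [LieGroup 𝓘(ℝ, EH) ∞ H]
    (X : LieCrossedModule EG G EH H) (c : Cocycle X) :
    ∃ e : IntegralGauge c ≃ DifferentialGauge EG G EH H,
      (∀ (T : IntegralGauge c) (x y : ℝ),
        (e T).ϰ (x, y) = T.κ x y ∧
        (e T).Γx x y = -X.mDot (T.κ x y) (leftLogDeriv (fun x' => T.Ψ x' x y) x) ∧
        (e T).Γy x y = -X.mDot (T.κ x y) (leftLogDeriv (fun y' => T.Φ x y' y) y)) ∧
      (∀ D : DifferentialGauge EG G EH H,
        (∀ x y : ℝ, (e.symm D).κ x y = D.ϰ (x, y)) ∧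
        (∀ x₀ y : ℝ, IsUniqueSolutionLeftLog (E := EH)
          (fun x => -X.mDot ((c.f x x₀ y)⁻¹ * (D.ϰ (x, y))⁻¹) (D.Γx x y)) x₀
          (fun x => (e.symm D).Ψ x x₀ y)) ∧
        (∀ x y₀ : ℝ, IsUniqueSolutionLeftLog (E := EH)
          (fun y => -X.mDot ((c.g x y y₀)⁻¹ * (D.ϰ (x, y))⁻¹) (D.Γy x y)) y₀
          (fun y => (e.symm D).Φ x y y₀))) := by
  refine ⟨Equiv.ofBijective IntegralGauge.toDifferential
    ⟨IntegralGauge.toDifferential_injective, IntegralGauge.toDifferential_surjective⟩,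
    fun T x y => ⟨rfl, T.toDifferential_Γx x y, T.toDifferential_Γy x y⟩, fun D => ?_⟩
  -- With `D` written as the image of `T`, the inverse returns `T`, and the required equations are
  -- those that `T` satisfies relative to its own image.
  obtain ⟨T, rfl⟩ := IntegralGauge.toDifferential_surjective (c := c) D
  have hT : (Equiv.ofBijective IntegralGauge.toDifferential
      ⟨IntegralGauge.toDifferential_injective, IntegralGauge.toDifferential_surjective⟩).symm
      T.toDifferential = T := Equiv.ofBijective_symm_apply_apply _ _ T
  rw [hT]
  exact ⟨fun x y => rfl,
    fun x₀ y => ⟨T.solvesLeftLog_Ψ x₀ y, fun γ hγ => hγ.unique (T.solvesLeftLog_Ψ x₀ y)⟩,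
    fun x y₀ => ⟨T.solvesLeftLog_Φ x y₀, fun γ hγ => hγ.unique (T.solvesLeftLog_Φ x y₀)⟩⟩
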